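/- **Theorem.** Over $\mathsf{RCA}_0$, $\mathsf{RKL}$ implies $\mathsf{DNR}$; that is, every model $(M,S)$ of $\mathsf{RCA}_0+\mathsf{RKL}$ is a model of $\mathsf{DNR}$. Here a model consists of a first-order part $M$ (not necessarily the standard natural numbers) with $0,1,+,\cdot,<$ and a collection $S$ of subsets of $M$ as second-order part. $\mathsf{RCA}_0$ consists of the usual basic axioms of arithmetic, induction for $\Sigma^0_1$ formulas with parameters, and comprehension for $\Delta^0_1$ formulas with parameters. The two principles, which are interpreted in the model with the quantifier "number" ranging over $M$, the quantifier "set" ranging over $S$, and finite strings, functions, programs and computations coded by numbers or sets in the usual way, are as follows. * A set $H$ is *homogeneous for $\sigma\in 2^{<\mathbb N}$ with color $c\in\{0,1\}$* if $\sigma(x)=c$ for each $x\in H$ with $x<|\sigma|$. A set $H$ is *homogeneous for a path through* a binary tree $T$ if there is $c\in\{0,1\}$ such that $H$ is homogeneous for $\sigma$ with color $c$ for arbitrarily long $\sigma\in T$. $\mathsf{RKL}$ asserts that for each infinite binary tree $T\subseteq 2^{<\mathbb N}$ (a set of strings closed under initial segments) there is an infinite set $H$ which is homogeneous for a path through $T$.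 * Let $\Phi_e^X$ be the partial function computed by the $e$-th program with oracle $X$, in the standard numbering given by register machine programs with oracle. A function $f:\mathbb N\to\mathbb N$ is *diagonally non-computable relative to $X$* if $f(e)\neq\Phi_e^X(e)$ for each $e$ such that $\Phi_e^X(e)$ converges. $\mathsf{DNR}$ asserts that for every set $X$ there is a function that is diagonally non-computable relative to $X$. -/

import Mathlib

/-! Second-order arithmetic. A structure for its language is a type `M` of numbers with
`0`, `1`, `+`, `*`, `<`, together with a collection `S : Set (Set M)` of subsets of `M` over which
the set variables range (a general, or Henkin, structure; `M` need not be the standard `ℕ`). -/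

namespace SOA

universe u

/-! ### Bounded formulas and the system `RCA₀` -/

section Formulas

variable (M : Type u) (S : Set (Set M))

/-- Number terms with number parameters from `M` (in particular `0` and `1`) and with the free
number variables `x₀, …, xₙ₋₁`. -/
inductive Tm : ℕ → Type u
  | var {n : ℕ} (i : Fin n) : Tm n
  | param {n : ℕ} (a : M) : Tm n
  | add {n : ℕ} (s t : Tm n) : Tm n
  | mul {n : ℕ} (s t : Tm n) : Tm n

variable {M}

/-- Bounded-quantifier formulas with number parameters from `M` and set parameters from `S`, in the
free number variables `x₀, …, xₙ₋₁`. In `ball t φ` (for all `x < t`, `φ`), the bound variable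
becomes variable `0` of `φ`, and the other variables are shifted by one. -/
inductive BForm : ℕ → Type u
  | eq {n : ℕ} (s t : Tm M n) : BForm n
  | lt {n : ℕ} (s t : Tm M n) : BForm n
  | mem {n : ℕ} (t : Tm M n) (A : S) : BForm n
  | neg {n : ℕ} (φ : BForm n) : BForm n
  | and {n : ℕ} (φ ψ : BForm n) : BForm n
  | ball {n : ℕ} (t : Tm M n) (φ : BForm (n + 1)) : BForm n

end Formulas

section Semantics

variable {M : Type u} [Zero M] [One M] [Add M] [Mul M] [LT M]

/-- The value of a term. -/
def Tm.eval : {n : ℕ} → Tm M n → (Fin n → M) → M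
  | _, .var i, v => v i
  | _, .param a, _ => a
  | _, .add s t, v => s.eval v + t.eval v
  | _, .mul s t, v => s.eval v * t.eval v

/-- Truth of a bounded formula in `(M, S)`. -/
def BForm.Holds {S : Set (Set M)} : {n : ℕ} → BForm S n → (Fin n → M) → Prop
  | _, .eq s t, v => s.eval v = t.eval v
  | _, .lt s t, v => s.eval v < t.eval v
  | _, .mem t A, v => t.eval v ∈ (A : Set M)
  | _, .neg φ, v => ¬ φ.Holds v
  | _, .and φ ψ, v => φ.Holds v ∧ ψ.Holds v
  | _, .ball t φ, v => ∀ a : M, a < t.eval v → φ.Holds (Fin.cons a v)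

/-- `Sig θ n` is the `Σ⁰₁` formula `∃ m, θ(m, n)`. -/
def Sig {S : Set (Set M)} (θ : BForm S 2) (n : M) : Prop := ∃ m : M, θ.Holds ![m, n]

/-- `Pi θ n` is the `Π⁰₁` formula `∀ m, θ(m, n)`. -/
def Pi {S : Set (Set M)} (θ : BForm S 2) (n : M) : Prop := ∀ m : M, θ.Holds ![m, n]

/-- `(M, S)` is a model of `RCA₀`: the basic axioms, induction for `Σ⁰₁` formulas with parameters,
and comprehension for `Δ⁰₁` formulas with parameters. -/
structure RCA0 (S : Set (Set M)) : Prop where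
  succ_ne_zero : ∀ n : M, n + 1 ≠ 0
  succ_inj : ∀ m n : M, m + 1 = n + 1 → m = n
  add_zero : ∀ m : M, m + 0 = m
  add_succ : ∀ m n : M, m + (n + 1) = (m + n) + 1
  mul_zero : ∀ m : M, m * 0 = 0
  mul_succ : ∀ m n : M, m * (n + 1) = m * n + m
  not_lt_zero : ∀ m : M, ¬ m < 0
  lt_succ : ∀ m n : M, m < n + 1 ↔ (m < n ∨ m = n)
  sigma_induction : ∀ θ : BForm S 2,
    Sig θ 0 → (∀ n, Sig θ n → Sig θ (n + 1)) → ∀ n, Sig θ n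
  delta_comprehension : ∀ θ η : BForm S 2,
    (∀ n, Sig θ n ↔ Pi η n) → ∃ A ∈ S, ∀ n, n ∈ A ↔ Sig θ n

/-! ### Coding inside a structure -/

/-- The pairing function `(i + j)² + i`. -/
def pair (i j : M) : M := (i + j) * (i + j) + i

/-- `A` is infinite, i.e. unbounded. -/
def Unbounded (A : Set M) : Prop := ∀ b : M, ∃ x ∈ A, b < x

/-- `F` is (the graph of) a function from numbers to numbers. -/
def IsFunction (F : Set M) : Prop :=
  (∀ z ∈ F, ∃ x y, z = pair x y) ∧ ∀ x, ∃! y, pair x y ∈ F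

/-- The number `σ` is a (not necessarily least) code `⟨l, ⟨m, n⟩⟩` of a string of length `l`. -/
def Len (σ l : M) : Prop := ∃ m n, σ = pair l (pair m n)

/-- The string coded by `σ = ⟨l, ⟨m, n⟩⟩` has the value `1` at `x < l`, which means that
`m(x+1)+1` divides `n`. -/
def IsOne (σ x : M) : Prop :=
  ∃ l m n, σ = pair l (pair m n) ∧ x < l ∧ ∃ k, n = (m * (x + 1) + 1) * k

/-- `τ` and `σ` code binary strings, and that of `τ` is an initial segment of that of `σ`. -/
def IsPrefix (τ σ : M) : Prop :=
  ∃ k l, Len τ k ∧ Len σ l ∧ ¬ l < k ∧ ∀ x, x < k → (IsOne τ x ↔ IsOne σ x)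

/-- `σ ∈ 2^{<ℕ}`: each binary string is identified with its least code. -/
def IsString (σ : M) : Prop :=
  (∃ l, Len σ l) ∧ ∀ τ, τ < σ → ¬ (IsPrefix τ σ ∧ IsPrefix σ τ)

/-- The string coded by `σ` has the value `c ∈ {0, 1}` at `x < |σ|`. -/
def HasValue (σ x c : M) : Prop :=
  (c = 1 ∧ IsOne σ x) ∨ (c = 0 ∧ ∃ l, Len σ l ∧ x < l ∧ ¬ IsOne σ x)

/-! ### The principle `RKL` -/

/-- `T ⊆ 2^{<ℕ}` is a binary tree. -/
def IsTree (T : Set M) : Prop :=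
  (∀ σ ∈ T, IsString σ) ∧ ∀ σ ∈ T, ∀ τ, IsString τ → IsPrefix τ σ → τ ∈ T

/-- `H` is homogeneous for the string `σ` with color `c`. -/
def HomogeneousFor (H : Set M) (σ c : M) : Prop :=
  ∀ l, Len σ l → ∀ x ∈ H, x < l → HasValue σ x c

/-- `H` is homogeneous for a path through `T`: for some color `c ∈ {0, 1}`, `H` is homogeneous with
color `c` for arbitrarily long `σ ∈ T`. -/
def HomogeneousForPath (H T : Set M) : Prop :=
  ∃ c : M, (c = 0 ∨ c = 1) ∧
    ∀ k : M, ∃ σ ∈ T, (∃ l, Len σ l ∧ k < l) ∧ HomogeneousFor H σ c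

/-- The Ramsey-type König's lemma holds in `(M, S)`. -/
def RKL (S : Set (Set M)) : Prop :=
  ∀ T ∈ S, IsTree T → Unbounded T → ∃ H ∈ S, Unbounded H ∧ HomogeneousForPath H T

/-! ### Oracle register machines and the principle `DNR` -/

/-- Gödel's beta function: the number `s = ⟨a, b⟩` codes a sequence whose entry at `i` is the
remainder of `a` modulo `b(i+1)+1`. -/
def Entry (s i v : M) : Prop :=
  ∃ a b, s = pair a b ∧ v < b * (i + 1) + 1 ∧ ∃ q, a = (b * (i + 1) + 1) * q + v

/-- In the program `e = ⟨k, s⟩`, which consists of `k` instructions, namely the first `k` entries of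
the sequence `s`, instruction `i < k` is `⟨op, ⟨r, j⟩⟩`. -/
def Instr (e i op r j : M) : Prop :=
  ∃ k s, e = pair k s ∧ i < k ∧ Entry s i (pair op (pair r j))

/-- The address `i` lies beyond the instructions of the program `e`. -/
def Halted (e i : M) : Prop := ∃ k s, e = pair k s ∧ ¬ i < k

/-- The effect, with oracle `X`, of an instruction with operation `op` and jump target `j`, located
at address `i`, when the register on which it acts contains `v`: the next address is `i'`, and the
new content of that register is `v'`. Operation `0` increments the register. Operation `1` jumps to
`j` if the register is zero and decrements it otherwise. Operation `2` jumps to `j` if the content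
of the register belongs to `X`. -/
def Effect (X : Set M) (op j i v i' v' : M) : Prop :=
  (op = 0 ∧ i' = i + 1 ∧ v' = v + 1) ∨
  (op = 1 ∧ ((v = 0 ∧ v' = 0 ∧ i' = j) ∨ (v = v' + 1 ∧ i' = i + 1))) ∨
  (op = 1 + 1 ∧ v' = v ∧ ((v ∈ X ∧ i' = j) ∨ (v ∉ X ∧ i' = i + 1)))

/-- In the history with addresses `p` (entry `t` of `p` is the address at time `t`) and register
contents `h` (entry `⟨t, r⟩` of `h` is the content of register `r < w` at time `t`), the program `e`
with oracle `X` makes a correct step from time `t` to time `t + 1`. -/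
def Step (X : Set M) (e w p h t : M) : Prop :=
  ∃ op r j i i' v v', Entry p t i ∧ Entry p (t + 1) i' ∧ Instr e i op r j ∧ r < w ∧
    Entry h (pair t r) v ∧ Entry h (pair (t + 1) r) v' ∧ Effect X op j i v i' v' ∧
    ∀ r', r' < w → r' ≠ r → ∃ z, Entry h (pair t r') z ∧ Entry h (pair (t + 1) r') z

/-- `Φ_e^X(x) = y`: there is a halting computation of the register machine program `e` with oracle
`X` that starts at address `0` with `x` in register `0` and with all other registers `0`, and that
ends with `y` in register `0`. The number `w` bounds the registers that are used. -/
def Phi (X : Set M) (e x y : M) : Prop :=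
  ∃ t w p h, 0 < w ∧ Entry p 0 0 ∧ Entry h (pair 0 0) x ∧
    (∀ r, r < w → r ≠ 0 → Entry h (pair 0 r) 0) ∧
    (∀ s, s < t → Step X e w p h s) ∧
    (∃ i, Entry p t i ∧ Halted e i) ∧ Entry h (pair t 0) y

/-- The function with graph `F` is diagonally non-computable relative to `X`. -/
def IsDNC (F X : Set M) : Prop :=
  IsFunction F ∧ ∀ e y, Phi X e e y → pair e y ∉ F

/-- The principle `DNR` holds in `(M, S)`. -/
def DNR (S : Set (Set M)) : Prop := ∀ X ∈ S, ∃ F ∈ S, IsDNC F X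

end Semantics

end SOA

namespace SOA

universe u

set_option linter.unusedSectionVars false
set_option synthInstance.maxSize 10000
set_option synthInstance.maxHeartbeats 200000

/-! ### Definability -/

section Definability

variable {M : Type u} {n k : ℕ}

/-! Read an output of the `e`-th program on input `e` as the code `y` of a sequence of `2e + 2`
distinct numbers. Let `T` be the tree of strings `σ` that are nonconstant on every such sequence, as
long as `e`, `y` and a witness of the computation lie below the length of `σ`. `T` is infinite
(`exists_splitsAll`): treat the `e` in increasing order and reserve two numbers for each. Only `2e`
numbers are reserved before `e`, so two of the `2e + 2` entries are still free; one gets color 0 and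
the other color 1.

Let `H` be an infinite set homogeneous for a path through `T`. No sequence output by program `e` on
input `e` can consist of `2e + 2` distinct elements of `H`, since a long enough `σ ∈ T` would be
both constant and nonconstant on it. So mapping `e` to the least code of `2e + 2` distinct elements
of `H` gives a diagonally non-computable function (`exists_diagonal`).

The rest makes this work in a possibly nonstandard model with only `Σ⁰₁` induction. The classes `D0`
and `S1` let instance search check the complexity of each induction formula, with `exists_bound`
absorbing bounded quantifiers. The Chinese remainder theorem gives coded sequences (`exists_seq`)
and strings (`exists_string`), `pigeonhole` supplies the free entries, and `Phi.unique` ensures that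
each `e` contributes only one sequence. -/

/-- Dropping the first coordinate. -/
def tl (v : Fin (n + 1) → M) : Fin n → M := fun i => v i.succ

theorem tl_cons (a : M) (v : Fin n → M) : tl (Fin.cons a v : Fin (n + 1) → M) = v :=
  funext fun _ => by simp [tl]

/-- A function selecting coordinates. -/
class IsProj (f : (Fin n → M) → (Fin k → M)) : Prop where
  out : ∃ g : Fin k → Fin n, ∀ v i, f v i = v (g i)

section Terms

variable [Add M] [Mul M]

/-- A function given by a term. -/
class IsTm (t : (Fin n → M) → M) : Prop where
  out : ∃ s : Tm M n, ∀ v, s.eval v = t v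

instance : IsProj (fun v : Fin n → M => v) := ⟨id, fun _ _ => rfl⟩

instance : IsProj (fun v : Fin (n + 1) → M => tl v) := ⟨Fin.succ, fun _ _ => rfl⟩

instance (f : (Fin n → M) → (Fin (k + 1) → M)) [h : IsProj f] :
    IsProj (fun v => tl (f v)) := by
  obtain ⟨g, hg⟩ := h.out
  exact ⟨fun i => g i.succ, fun v i => hg v i.succ⟩

instance (f : (Fin n → M) → (Fin k → M)) [h : IsProj f] (i : Fin k) : IsTm (fun v => f v i) := by
  obtain ⟨g, hg⟩ := h.out
  exact ⟨.var (g i), fun v => by rw [Tm.eval, hg]⟩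

instance (c : M) : IsTm (fun _ : Fin n → M => c) := ⟨.param c, fun _ => by rw [Tm.eval]⟩

instance IsTm.add (t s : (Fin n → M) → M) [ht : IsTm t] [hs : IsTm s] :
    IsTm (fun v => t v + s v) := by
  obtain ⟨t', ht⟩ := ht.out
  obtain ⟨s', hs⟩ := hs.out
  exact ⟨.add t' s', fun v => by simp [Tm.eval, ht, hs]⟩

instance IsTm.mul (t s : (Fin n → M) → M) [ht : IsTm t] [hs : IsTm s] :
    IsTm (fun v => t v * s v) := by
  obtain ⟨t', ht⟩ := ht.out
  obtain ⟨s', hs⟩ := hs.out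
  exact ⟨.mul t' s', fun v => by simp [Tm.eval, ht, hs]⟩

instance (t s : (Fin n → M) → M) [IsTm t] [IsTm s] : IsTm (fun v => pair (t v) (s v)) := by
  unfold pair; infer_instance

theorem Tm.exists_subst {m : ℕ} (f : Fin n → (Fin m → M) → M) (hf : ∀ i, IsTm (f i)) (s : Tm M n) :
    IsTm (fun v => s.eval (fun i => f i v)) := by
  induction s with
  | var i => simp only [Tm.eval]; exact hf i
  | param a => simp only [Tm.eval]; infer_instance
  | add s t hs ht => simp only [Tm.eval]; infer_instance
  | mul s t hs ht => simp only [Tm.eval]; infer_instance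

theorem IsTm.tail (t : (Fin n → M) → M) [h : IsTm t] :
    IsTm (fun w : Fin (n + 1) → M => t (tl w)) := by
  obtain ⟨s, hs⟩ := h.out
  simp only [← hs]
  exact s.exists_subst (fun i w => w i.succ) fun i => inferInstance

end Terms

variable [Add M] [Mul M] [LT M] {S : Set (Set M)}

variable (S) in
/-- A relation defined by a bounded formula with parameters. -/
class D0 (P : (Fin n → M) → Prop) : Prop where
  out : ∃ φ : BForm S n, ∀ v, φ.Holds v ↔ P v

variable (S) in
/-- A relation defined by a `Σ⁰₁` formula with parameters. -/
class S1 (P : (Fin n → M) → Prop) : Prop where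
  out : ∃ Q : (Fin (n + 1) → M) → Prop, D0 S Q ∧ ∀ v, P v ↔ ∃ m, Q (Fin.cons m v)

theorem D0.congr {P Q : (Fin n → M) → Prop} (h : ∀ v, P v ↔ Q v) [hQ : D0 S Q] : D0 S P := by
  rwa [show P = Q from funext fun v => propext (h v)]

theorem S1.congr {P Q : (Fin n → M) → Prop} (h : ∀ v, P v ↔ Q v) [hQ : S1 S Q] : S1 S P := by
  rwa [show P = Q from funext fun v => propext (h v)]

instance D0.eq (t s : (Fin n → M) → M) [ht : IsTm t] [hs : IsTm s] :
    D0 S (fun v => t v = s v) := by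
  obtain ⟨t', ht⟩ := ht.out
  obtain ⟨s', hs⟩ := hs.out
  exact ⟨.eq t' s', fun v => by simp [BForm.Holds, ht, hs]⟩

instance D0.lt (t s : (Fin n → M) → M) [ht : IsTm t] [hs : IsTm s] :
    D0 S (fun v => t v < s v) := by
  obtain ⟨t', ht⟩ := ht.out
  obtain ⟨s', hs⟩ := hs.out
  exact ⟨.lt t' s', fun v => by simp [BForm.Holds, ht, hs]⟩

instance D0.mem (A : Set M) [hA : Fact (A ∈ S)] (t : (Fin n → M) → M) [ht : IsTm t] :
    D0 S (fun v => t v ∈ A) := by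
  obtain ⟨t', ht⟩ := ht.out
  exact ⟨.mem t' ⟨A, hA.out⟩, fun v => by simp [BForm.Holds, ht]⟩

instance D0.not (P : (Fin n → M) → Prop) [h : D0 S P] : D0 S (fun v => ¬ P v) := by
  obtain ⟨φ, h⟩ := h.out
  exact ⟨.neg φ, fun v => by simp [BForm.Holds, h]⟩

instance D0.and (P Q : (Fin n → M) → Prop) [h : D0 S P] [h' : D0 S Q] :
    D0 S (fun v => P v ∧ Q v) := by
  obtain ⟨φ, h⟩ := h.out
  obtain ⟨ψ, h'⟩ := h'.out
  exact ⟨.and φ ψ, fun v => by simp [BForm.Holds, h, h']⟩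

instance D0.or (P Q : (Fin n → M) → Prop) [h : D0 S P] [h' : D0 S Q] :
    D0 S (fun v => P v ∨ Q v) :=
  D0.congr (Q := fun v => ¬ (¬ P v ∧ ¬ Q v)) fun v => by tauto

instance D0.imp (P Q : (Fin n → M) → Prop) [h : D0 S P] [h' : D0 S Q] :
    D0 S (fun v => P v → Q v) :=
  D0.congr (Q := fun v => ¬ (P v ∧ ¬ Q v)) fun v => by tauto

instance D0.iff (P Q : (Fin n → M) → Prop) [h : D0 S P] [h' : D0 S Q] :
    D0 S (fun v => P v ↔ Q v) :=
  D0.congr (Q := fun v => (P v → Q v) ∧ (Q v → P v)) fun v => by tauto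

instance D0.ball (Q : M → (Fin n → M) → Prop) (t : (Fin n → M) → M) [ht : IsTm t]
    [h : D0 S (fun w : Fin (n + 1) → M => Q (w 0) (tl w))] :
    D0 S (fun v => ∀ a, a < t v → Q a v) := by
  obtain ⟨φ, h⟩ := h.out
  obtain ⟨t', ht⟩ := ht.out
  exact ⟨.ball t' φ, fun v => by simp [BForm.Holds, h, ht, tl_cons]⟩

instance D0.bex (Q : M → (Fin n → M) → Prop) (t : (Fin n → M) → M) [ht : IsTm t]
    [h : D0 S (fun w : Fin (n + 1) → M => Q (w 0) (tl w))] :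
    D0 S (fun v => ∃ a, a < t v ∧ Q a v) :=
  D0.congr (Q := fun v => ¬ ∀ a, a < t v → ¬ Q a v) fun v => by push Not; rfl

/-- Under a bounded quantifier the substitution keeps the new variable `0` and acts on the tail;
hence the induction is uniform in `m` and `f`. -/
theorem BForm.exists_subst {m : ℕ} (f : Fin n → (Fin m → M) → M) (hf : ∀ i, IsTm (f i))
    (φ : BForm S n) : D0 S (fun v => φ.Holds (fun i => f i v)) := by
  induction φ generalizing m with
  | eq s t =>
    have := s.exists_subst f hf; have := t.exists_subst f hf
    simp only [Holds]; infer_instance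
  | lt s t =>
    have := s.exists_subst f hf; have := t.exists_subst f hf
    simp only [Holds]; infer_instance
  | mem t A =>
    have := t.exists_subst f hf; have : Fact ((A : Set M) ∈ S) := ⟨A.2⟩
    simp only [Holds]; infer_instance
  | neg φ h => have := h f hf; simp only [Holds]; infer_instance
  | and φ ψ h h' => have := h f hf; have := h' f hf; simp only [Holds]; infer_instance
  | @ball n t φ h =>
    have ht := t.exists_subst f hf
    have := h (Fin.cons (fun w => w 0) fun i w => f i (tl w))
      (fun i => by
        refine Fin.cases ?_ (fun i => ?_) i
        · exact (inferInstance : IsTm fun w : Fin (m + 1) → M => w 0)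
        · have := hf i; exact IsTm.tail (f i))
    simp only [Holds]
    have key : D0 S (fun w : Fin (m + 1) → M =>
        φ.Holds (Fin.cons (w 0) (fun i => f i (tl w)))) := by
      convert this using 3 with w
      refine funext fun i => ?_
      refine Fin.cases ?_ (fun i => ?_) i <;> simp
    exact D0.ball (fun a v => φ.Holds (Fin.cons a (fun i => f i v))) _

theorem D0.subst {m : ℕ} (P : (Fin n → M) → Prop) [h : D0 S P] (f : Fin n → (Fin m → M) → M)
    (hf : ∀ i, IsTm (f i)) : D0 S (fun v => P (fun i => f i v)) := by
  obtain ⟨φ, h⟩ := h.out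
  simp only [← h]
  exact φ.exists_subst f hf

/-- Adding a dummy variable. -/
theorem D0.tail (P : (Fin n → M) → Prop) [D0 S P] :
    D0 S (fun w : Fin (n + 1) → M => P (tl w)) :=
  D0.subst P (fun i w => w i.succ) fun _ => inferInstance

instance (priority := 100) S1.of_D0 [Zero M] (P : (Fin n → M) → Prop) [D0 S P] : S1 S P :=
  ⟨fun w => P (tl w), D0.tail P, fun v => by
    simp only [tl_cons]; exact ⟨fun h => ⟨0, h⟩, fun ⟨_, h⟩ => h⟩⟩

theorem S1.ex_D0 (Q : M → (Fin n → M) → Prop)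
    [h : D0 S (fun w : Fin (n + 1) → M => Q (w 0) (tl w))] :
    S1 S (fun v => ∃ a, Q a v) :=
  ⟨_, h, fun v => by simp [tl_cons]⟩

theorem S1.exists_sig (P : M → Prop) [h : S1 S (fun v : Fin 1 → M => P (v 0))] :
    ∃ θ : BForm S 2, ∀ a, Sig θ a ↔ P a := by
  obtain ⟨Q, hQ, h⟩ := h.out
  obtain ⟨φ, hφ⟩ := hQ.out
  refine ⟨φ, fun a => ?_⟩
  have := h ![a]
  simp only [Matrix.cons_val_zero] at this
  rw [this]
  exact exists_congr fun m => hφ _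

end Definability

/-! ### Semiring and order laws from the axioms of `RCA₀` -/

section Axioms

variable {M : Type u} [Zero M] [One M] [Add M] [Mul M] [LT M] {S : Set (Set M)}

theorem RCA0.induction (h : RCA0 S) (P : M → Prop) [hP : S1 S (fun v : Fin 1 → M => P (v 0))]
    (zero : P 0) (succ : ∀ a, P a → P (a + 1)) (a : M) : P a := by
  obtain ⟨θ, hθ⟩ := S1.exists_sig (S := S) P
  have := h.sigma_induction θ
  simp only [hθ] at this
  exact this zero succ a

theorem RCA0.comprehension (h : RCA0 S) (P : M → Prop)
    (hP : D0 S (fun v : Fin 1 → M => P (v 0)) := by infer_instance) : ∃ A ∈ S, ∀ a, a ∈ A ↔ P a := by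
  -- The formula ignores its quantified variable `0`, so its `Σ⁰₁` and `Π⁰₁` closures coincide and
  -- it serves on both sides.
  obtain ⟨φ, hφ⟩ := (D0.subst (S := S) (fun v : Fin 1 → M => P (v 0)) (m := 2) (fun _ w => w 1)
    fun _ => inferInstance).out
  obtain ⟨A, hA, hA'⟩ := h.delta_comprehension φ φ fun a => by simp [Sig, Pi, hφ]
  exact ⟨A, hA, fun a => by simp [hA', Sig, hφ]⟩

theorem RCA0.zero_add (h : RCA0 S) (a : M) : 0 + a = a := by
  refine h.induction (fun a => 0 + a = a) (h.add_zero 0) (fun a ih => ?_) a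
  rw [h.add_succ, ih]

theorem RCA0.add_assoc (h : RCA0 S) (a b c : M) : a + b + c = a + (b + c) := by
  refine h.induction (fun c => a + b + c = a + (b + c)) ?_ (fun c ih => ?_) c
  · rw [h.add_zero, h.add_zero]
  · rw [h.add_succ, h.add_succ, h.add_succ, ih]

theorem RCA0.succ_add (h : RCA0 S) (a b : M) : a + 1 + b = a + b + 1 := by
  refine h.induction (fun b => a + 1 + b = a + b + 1) ?_ (fun b ih => ?_) b
  · rw [h.add_zero, h.add_zero]
  · rw [h.add_succ, h.add_succ, ih]

theorem RCA0.add_comm (h : RCA0 S) (a b : M) : a + b = b + a := by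
  refine h.induction (fun b => a + b = b + a) ?_ (fun b ih => ?_) b
  · rw [h.add_zero, h.zero_add]
  · rw [h.add_succ, h.succ_add, ih]

theorem RCA0.add_right_cancel (h : RCA0 S) (a b c : M) (e : a + c = b + c) : a = b := by
  revert e
  refine h.induction (fun c => a + c = b + c → a = b) ?_ (fun c ih => ?_) c
  · rw [h.add_zero, h.add_zero]; exact id
  · rw [h.add_succ, h.add_succ]; exact fun e => ih (h.succ_inj _ _ e)

theorem RCA0.left_distrib (h : RCA0 S) (a b c : M) : a * (b + c) = a * b + a * c := by
  refine h.induction (fun c => a * (b + c) = a * b + a * c) ?_ (fun c ih => ?_) c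
  · rw [h.add_zero, h.mul_zero, h.add_zero]
  · rw [h.add_succ, h.mul_succ, h.mul_succ, ih, h.add_assoc]

theorem RCA0.zero_mul (h : RCA0 S) (a : M) : 0 * a = 0 := by
  refine h.induction (fun a => 0 * a = 0) (h.mul_zero 0) (fun a ih => ?_) a
  rw [h.mul_succ, ih, h.add_zero]

theorem RCA0.succ_mul (h : RCA0 S) (a b : M) : (a + 1) * b = a * b + b := by
  refine h.induction (fun b => (a + 1) * b = a * b + b) ?_ (fun b ih => ?_) b
  · rw [h.mul_zero, h.mul_zero, h.add_zero]
  · rw [h.mul_succ, h.mul_succ, ih, h.add_assoc, h.add_assoc,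
      h.add_succ b, h.add_succ a, h.add_comm b a]

theorem RCA0.mul_comm (h : RCA0 S) (a b : M) : a * b = b * a := by
  refine h.induction (fun b => a * b = b * a) ?_ (fun b ih => ?_) b
  · rw [h.mul_zero, h.zero_mul]
  · rw [h.mul_succ, h.succ_mul, ih]

theorem RCA0.mul_assoc (h : RCA0 S) (a b c : M) : a * b * c = a * (b * c) := by
  refine h.induction (fun c => a * b * c = a * (b * c)) ?_ (fun c ih => ?_) c
  · rw [h.mul_zero, h.mul_zero, h.mul_zero]
  · rw [h.mul_succ, h.mul_succ, h.left_distrib, ih]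

theorem RCA0.mul_one (h : RCA0 S) (a : M) : a * 1 = a := by
  rw [← h.zero_add 1, h.mul_succ, h.mul_zero, h.zero_add]

/-- The semiring structure of a model of `RCA₀`. -/
@[reducible] def RCA0.commSemiring (h : RCA0 S) : CommSemiring M where
  add_assoc := h.add_assoc
  zero_add := h.zero_add
  add_zero := h.add_zero
  nsmul := nsmulRec
  add_comm := h.add_comm
  left_distrib := h.left_distrib
  right_distrib a b c := by
    rw [h.mul_comm, h.left_distrib, h.mul_comm c a, h.mul_comm c b]
  zero_mul := h.zero_mul
  mul_zero := h.mul_zero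
  mul_assoc := h.mul_assoc
  one_mul a := by rw [h.mul_comm, h.mul_one]
  mul_one := h.mul_one
  mul_comm := h.mul_comm

/-- The axioms describe `<` only through `0` and successors; this link with addition is what the
other order laws rest on. -/
theorem RCA0.lt_iff (h : RCA0 S) (a b : M) : a < b ↔ ∃ c, a + (c + 1) = b := by
  constructor
  -- The witness is pulled in front of the implication to get a `Σ⁰₁` induction formula; `0` is a
  -- dummy value when the premise fails.
  · have : S1 S (fun v : Fin 1 → M => a < v 0 → ∃ c, a + (c + 1) = v 0) := by
      refine @S1.congr _ _ _ _ _ _ _ (fun v => ∃ c, a < v 0 → a + (c + 1) = v 0) (fun v => ?_)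
        (S1.ex_D0 (fun c v => a < v 0 → a + (c + 1) = v 0))
      constructor
      · intro H
        by_cases ha : a < v 0
        · obtain ⟨c, hc⟩ := H ha
          exact ⟨c, fun _ => hc⟩
        · exact ⟨0, fun H => (ha H).elim⟩
      · rintro ⟨c, hc⟩ ha
        exact ⟨c, hc ha⟩
    refine h.induction (fun b => a < b → ∃ c, a + (c + 1) = b)
      (fun H => (h.not_lt_zero _ H).elim) (fun b ih H => ?_) b
    rcases (h.lt_succ _ _).1 H with H | rfl
    · obtain ⟨c, rfl⟩ := ih H
      exact ⟨c + 1, h.add_succ _ _⟩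
    · exact ⟨0, by rw [h.zero_add]⟩
  · rintro ⟨c, rfl⟩
    refine h.induction (fun c => a < a + (c + 1)) ?_ (fun c ih => ?_) c
    · rw [h.zero_add, h.lt_succ]; exact .inr rfl
    · rw [h.add_succ, h.lt_succ]; exact .inl ih

theorem RCA0.lt_trichotomy (h : RCA0 S) (a b : M) : a < b ∨ a = b ∨ b < a := by
  refine h.induction (fun b => a < b ∨ a = b ∨ b < a) ?_ (fun b ih => ?_) b
  · refine h.induction (fun a => a < 0 ∨ a = 0 ∨ 0 < a) (.inr (.inl rfl)) (fun a _ => ?_) a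
    exact .inr (.inr ((h.lt_iff _ _).2 ⟨a, h.zero_add _⟩))
  · rw [h.lt_succ]
    rcases ih with H | H | H
    · exact .inl (.inl H)
    · exact .inl (.inr H)
    · obtain ⟨c, rfl⟩ := (h.lt_iff _ _).1 H
      refine h.induction (fun c => (b + (c + 1) < b ∨ b + (c + 1) = b) ∨
        b + (c + 1) = b + 1 ∨ b + 1 < b + (c + 1)) (.inr (.inl (by rw [h.zero_add])))
        (fun c _ => .inr (.inr ?_)) c
      rw [h.add_comm c 1, h.add_assoc, ← h.add_assoc b]
      exact (h.lt_iff _ _).2 ⟨c, rfl⟩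

theorem RCA0.lt_trans (h : RCA0 S) {a b c : M} (h₁ : a < b) (h₂ : b < c) : a < c := by
  obtain ⟨d, rfl⟩ := (h.lt_iff _ _).1 h₁
  obtain ⟨e, rfl⟩ := (h.lt_iff _ _).1 h₂
  exact (h.lt_iff _ _).2 ⟨d + 1 + e, by rw [h.add_assoc a, h.add_assoc (d + 1)]⟩

theorem RCA0.lt_irrefl (h : RCA0 S) (a : M) : ¬ a < a := by
  intro H
  obtain ⟨d, hd⟩ := (h.lt_iff _ _).1 H
  refine h.succ_ne_zero d (h.add_right_cancel _ _ a ?_)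
  rw [h.add_comm, hd, h.zero_add]

open Classical in
/-- The order of a model of `RCA₀`. -/
@[reducible] noncomputable def RCA0.linearOrder (h : RCA0 S) : LinearOrder M where
  le a b := a < b ∨ a = b
  lt := (· < ·)
  le_refl a := .inr rfl
  le_trans a b c := by
    rintro (H | rfl) (H' | rfl)
    · exact .inl (h.lt_trans H H')
    · exact .inl H
    · exact .inl H'
    · exact .inr rfl
  lt_iff_le_not_ge a b := by
    constructor
    · intro H
      refine ⟨.inl H, ?_⟩
      rintro (H' | rfl)
      · exact h.lt_irrefl _ (h.lt_trans H H')
      · exact h.lt_irrefl _ H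
    · rintro ⟨H | rfl, H'⟩
      · exact H
      · exact (H' (.inr rfl)).elim
  le_antisymm a b := by
    rintro (H | rfl) (H' | H')
    · exact (h.lt_irrefl _ (h.lt_trans H H')).elim
    · exact H'.symm
    · rfl
    · rfl
  le_total a b := by
    rcases h.lt_trichotomy a b with H | H | H
    · exact .inl (.inl H)
    · exact .inl (.inr H)
    · exact .inr (.inl H)
  toDecidableLE := Classical.decRel _

theorem RCA0.le_iff (h : RCA0 S) (a b : M) : (a < b ∨ a = b) ↔ ∃ c, b = a + c := by
  constructor
  · rintro (H | rfl)
    · obtain ⟨d, rfl⟩ := (h.lt_iff _ _).1 H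
      exact ⟨_, rfl⟩
    · exact ⟨0, (h.add_zero a).symm⟩
  · rintro ⟨c, rfl⟩
    refine h.induction (fun c => a < a + c ∨ a = a + c) (.inr (h.add_zero a).symm)
      (fun c _ => .inl ((h.lt_iff _ _).2 ⟨c, rfl⟩)) c

end Axioms

/-! ### Substituting tuples of terms into definable relations -/

section Tuples

variable {M : Type u} [Add M] [Mul M] {n m : ℕ}

/-- A tuple of terms. -/
class IsTuple (g : (Fin m → M) → (Fin n → M)) : Prop where
  out : ∀ i, IsTm (fun w => g w i)

instance (g : (Fin m → M) → (Fin n → M)) [IsProj g] : IsTuple g := ⟨fun _ => inferInstance⟩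

instance (t : (Fin m → M) → M) (g : (Fin m → M) → (Fin n → M)) [IsTm t] [h : IsTuple g] :
    IsTuple (fun w => (Fin.cons (t w) (g w) : Fin (n + 1) → M)) := by
  refine ⟨fun i => ?_⟩
  refine Fin.cases ?_ (fun i => ?_) i <;> simp only [Fin.cons_zero, Fin.cons_succ]
  · infer_instance
  · exact h.out i

theorem D0.comp [LT M] {S : Set (Set M)} (P : (Fin n → M) → Prop) [D0 S P]
    (g : (Fin m → M) → (Fin n → M)) [h : IsTuple g] : D0 S (fun w => P (g w)) :=
  D0.subst P (fun i w => g w i) h.out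

/-- Provides a matrix that remains definable after any substitution of terms, so that instance
search can use it inside further formulas. -/
theorem S1.exists_repr [LT M] {S : Set (Set M)} (P : (Fin n → M) → Prop) [h : S1 S P] :
    ∃ Q : M → (Fin n → M) → Prop, (∀ v, P v ↔ ∃ m, Q m v) ∧
      ∀ {m : ℕ} (t : (Fin m → M) → M) (f : (Fin m → M) → (Fin n → M)) [IsTm t] [IsTuple f],
        D0 S (fun w => Q (t w) (f w)) := by
  obtain ⟨Q, hQ, h⟩ := h.out
  exact ⟨fun m v => Q (Fin.cons m v), h, fun t f _ _ => D0.comp Q _⟩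

theorem S1.comp [LT M] {S : Set (Set M)} (P : (Fin n → M) → Prop) [S1 S P]
    (g : (Fin m → M) → (Fin n → M)) [h : IsTuple g] : S1 S (fun w => P (g w)) := by
  obtain ⟨Q, hQ, _⟩ := S1.exists_repr (S := S) P
  have : IsTuple (fun w : Fin (m + 1) → M => g (tl w)) :=
    ⟨fun i => have := h.out i; IsTm.tail (fun w => g w i)⟩
  exact @S1.congr _ _ _ _ _ _ _ _ (fun v => hQ _) (S1.ex_D0 fun a v => Q a (g v))

instance (a : Fin n → M) : IsTuple (fun _ : Fin m → M => a) := ⟨fun _ => inferInstance⟩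

theorem D0.rel₂ [LT M] {S : Set (Set M)} (R : M → M → Prop)
    [D0 S (fun v : Fin 2 → M => R (v 0) (v 1))] (s t : (Fin n → M) → M) [IsTm s] [IsTm t] :
    D0 S (fun v => R (s v) (t v)) :=
  D0.comp (S := S) (fun v : Fin 2 → M => R (v 0) (v 1))
    (fun w => Fin.cons (s w) (Fin.cons (t w) Fin.elim0))

theorem D0.rel₃ [LT M] {S : Set (Set M)} (R : M → M → M → Prop)
    [D0 S (fun v : Fin 3 → M => R (v 0) (v 1) (v 2))] (s t u : (Fin n → M) → M)
    [IsTm s] [IsTm t] [IsTm u] : D0 S (fun v => R (s v) (t v) (u v)) :=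
  D0.comp (S := S) (fun v : Fin 3 → M => R (v 0) (v 1) (v 2))
    (fun w => Fin.cons (s w) (Fin.cons (t w) (Fin.cons (u w) Fin.elim0)))

end Tuples

/-! ### Closure of `Σ⁰₁` relations, least elements and collection -/

section Closure

variable {M : Type u} [CommSemiring M] [LinearOrder M] [IsStrictOrderedRing M]
  [CanonicallyOrderedAdd M] [SuccAddOrder M] {S : Set (Set M)} {n k : ℕ}

instance D0.le (t s : (Fin n → M) → M) [IsTm t] [IsTm s] : D0 S (fun v => t v ≤ s v) :=
  D0.congr (Q := fun v => ¬ s v < t v) fun v => by simp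

instance D0.ne (t s : (Fin n → M) → M) [IsTm t] [IsTm s] : D0 S (fun v => t v ≠ s v) :=
  D0.congr (Q := fun v => ¬ s v = t v) fun v => by simp [eq_comm]

instance D0.ballLE (Q : M → (Fin n → M) → Prop) (t : (Fin n → M) → M) [IsTm t]
    [h : D0 S (fun w : Fin (n + 1) → M => Q (w 0) (tl w))] :
    D0 S (fun v => ∀ a, a ≤ t v → Q a v) :=
  D0.congr (Q := fun v => ∀ a, a < t v + 1 → Q a v) fun v => by simp

instance D0.bexLE (Q : M → (Fin n → M) → Prop) (t : (Fin n → M) → M) [IsTm t]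
    [h : D0 S (fun w : Fin (n + 1) → M => Q (w 0) (tl w))] :
    D0 S (fun v => ∃ a, a ≤ t v ∧ Q a v) :=
  D0.congr (Q := fun v => ∃ a, a < t v + 1 ∧ Q a v) fun v => by simp

/-- One number bounding both witnesses merges two unbounded quantifiers into one. -/
instance S1.and (P Q : (Fin n → M) → Prop) [S1 S P] [S1 S Q] : S1 S (fun v => P v ∧ Q v) := by
  obtain ⟨P', hP, _⟩ := S1.exists_repr (S := S) P
  obtain ⟨Q', hQ, _⟩ := S1.exists_repr (S := S) Q
  refine @S1.congr _ _ _ _ _ _ _ _ (fun v => ?_)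
    (S1.ex_D0 fun m v => (∃ a, a ≤ m ∧ P' a v) ∧ (∃ b, b ≤ m ∧ Q' b v))
  rw [hP, hQ]
  constructor
  · rintro ⟨⟨a, ha⟩, ⟨b, hb⟩⟩
    exact ⟨max a b, ⟨a, le_max_left _ _, ha⟩, ⟨b, le_max_right _ _, hb⟩⟩
  · rintro ⟨m, ⟨a, -, ha⟩, ⟨b, -, hb⟩⟩
    exact ⟨⟨a, ha⟩, ⟨b, hb⟩⟩

instance S1.or (P Q : (Fin n → M) → Prop) [S1 S P] [S1 S Q] : S1 S (fun v => P v ∨ Q v) := by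
  obtain ⟨P', hP, _⟩ := S1.exists_repr (S := S) P
  obtain ⟨Q', hQ, _⟩ := S1.exists_repr (S := S) Q
  refine @S1.congr _ _ _ _ _ _ _ _ (fun v => ?_) (S1.ex_D0 fun m v => P' m v ∨ Q' m v)
  rw [hP, hQ, exists_or]

instance S1.imp (P Q : (Fin n → M) → Prop) [D0 S P] [S1 S Q] : S1 S (fun v => P v → Q v) :=
  S1.congr (Q := fun v => ¬ P v ∨ Q v) fun v => by tauto

instance S1.ex (Q : M → (Fin n → M) → Prop)
    [S1 S (fun w : Fin (n + 1) → M => Q (w 0) (tl w))] : S1 S (fun v => ∃ a, Q a v) := by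
  obtain ⟨R, hR, _⟩ := S1.exists_repr (S := S) (fun w : Fin (n + 1) → M => Q (w 0) (tl w))
  have := fun (a : M) (v : Fin n → M) => hR (Fin.cons a v)
  simp only [Fin.cons_zero, tl_cons] at this
  refine @S1.congr _ _ _ _ _ _ _ _ (fun v => ?_)
    (S1.ex_D0 fun m v => ∃ a, a ≤ m ∧ ∃ b, b ≤ m ∧ R b (Fin.cons a v))
  simp only [this]
  constructor
  · rintro ⟨a, b, h⟩
    exact ⟨max a b, a, le_max_left _ _, b, le_max_right _ _, h⟩
  · rintro ⟨m, a, -, b, -, h⟩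
    exact ⟨a, b, h⟩

omit [IsStrictOrderedRing M] [CanonicallyOrderedAdd M] [SuccAddOrder M] in
theorem sig_induction (S : Set (Set M)) [hS : Fact (RCA0 S)] (P : M → Prop)
    (zero : P 0) (succ : ∀ a, P a → P (a + 1))
    (_ : S1 S (fun v : Fin 1 → M => P (v 0)) := by infer_instance) : ∀ a, P a :=
  hS.out.induction P zero succ

/-- If no least element existed, the bounded formula "nothing below `a` satisfies `P`" would be
inductive. -/
theorem exists_least (S : Set (Set M)) [Fact (RCA0 S)] (P : M → Prop)
    {a : M} (ha : P a) (_ : D0 S (fun v : Fin 1 → M => P (v 0)) := by infer_instance) :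
    ∃ a, P a ∧ ∀ b, b < a → ¬ P b := by
  by_contra! H
  have : D0 S (fun v : Fin 2 → M => P (v 0)) :=
    D0.comp (S := S) (fun v : Fin 1 → M => P (v 0)) (m := 2) (fun w => Fin.cons (w 0) (tl (tl w)))
  have h := (sig_induction S (fun a => ∀ b, b < a → ¬ P b) (by simp) (fun a ih b hb hP => by
    obtain ⟨c, hc, hc'⟩ := H b hP
    exact ih c (hc.trans_le (Order.lt_add_one_iff.1 hb)) hc')) (a + 1)
  exact h a (Order.lt_add_one_iff.2 le_rfl) ha

/-- `Σ⁰₁` collection. -/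
theorem exists_bound [Fact (RCA0 S)] (Q : M → M → Prop)
    (hQ : ∀ {n : ℕ} (s t : (Fin n → M) → M) [IsTm s] [IsTm t], D0 S (fun v => Q (s v) (t v))) (l : M)
    (h : ∀ a, a < l → ∃ m, Q m a) : ∃ b, ∀ a, a < l → ∃ m, m ≤ b ∧ Q m a := by
  -- The guard `u ≤ l` lets the hypothesis `h` stay outside the induction formula, which thus
  -- remains `Σ⁰₁`.
  have := (sig_induction S (fun u => u ≤ l → ∃ b, ∀ a, a < u → ∃ m, m ≤ b ∧ Q m a)
    (fun _ => ⟨0, by simp⟩) (fun u ih hu => by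
      obtain ⟨b, hb⟩ := ih ((Order.le_succ u).trans (by simpa using hu))
      obtain ⟨m, hm⟩ := h u (Order.add_one_le_iff.1 hu)
      refine ⟨max b m, fun a ha => ?_⟩
      rcases (Order.lt_add_one_iff.1 ha).lt_or_eq with ha | rfl
      · obtain ⟨c, hc, hc'⟩ := hb a ha
        exact ⟨c, le_max_of_le_left hc, hc'⟩
      · exact ⟨m, le_max_right _ _, hm⟩)) l le_rfl
  exact this

instance S1.ball [Fact (RCA0 S)] (Q : M → (Fin n → M) → Prop) (t : (Fin n → M) → M) [IsTm t]
    [S1 S (fun w : Fin (n + 1) → M => Q (w 0) (tl w))] : S1 S (fun v => ∀ a, a < t v → Q a v) := by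
  obtain ⟨R, hR, hRD⟩ := S1.exists_repr (S := S) (fun w : Fin (n + 1) → M => Q (w 0) (tl w))
  have := fun (a : M) (v : Fin n → M) => hR (Fin.cons a v)
  simp only [Fin.cons_zero, tl_cons] at this
  have ht := IsTm.tail t
  refine @S1.congr _ _ _ _ _ _ _ _ (fun v => ?_)
    (S1.ex_D0 fun m v => ∀ a, a < t v → ∃ b, b ≤ m ∧ R b (Fin.cons a v))
  simp only [this]
  constructor
  · intro h
    refine exists_bound (S := S) (fun b a => R b (Fin.cons a v)) (fun s t _ _ => ?_) _ h
    have h : IsTuple (fun w => (Fin.cons (t w) v : Fin (_ + 1) → M)) := ⟨fun i => by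
      refine Fin.cases ?_ (fun i => ?_) i <;> simp only [Fin.cons_zero, Fin.cons_succ] <;>
        infer_instance⟩
    exact hRD _ _
  · rintro ⟨m, h⟩ a ha
    obtain ⟨b, -, hb⟩ := h a ha
    exact ⟨b, hb⟩

instance S1.ballLE [Fact (RCA0 S)] (Q : M → (Fin n → M) → Prop) (t : (Fin n → M) → M) [IsTm t]
    [h : S1 S (fun w : Fin (n + 1) → M => Q (w 0) (tl w))] :
    S1 S (fun v => ∀ a, a ≤ t v → Q a v) :=
  S1.congr (Q := fun v => ∀ a, a < t v + 1 → Q a v) fun v => by simp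

end Closure

/-! ### Pairing, division with remainder and the beta function -/

section Arithmetic

variable {M : Type u} [CommSemiring M] [LinearOrder M] [IsStrictOrderedRing M]
  [CanonicallyOrderedAdd M] [SuccAddOrder M] {S : Set (Set M)} {n : ℕ}

theorem le_mul_of_pos {a b : M} (h : 0 < b) : a ≤ a * b :=
  le_mul_of_one_le_right (zero_le) (Order.one_le_iff_pos.2 h)

/-- `(i + j)² + i` stays below `(i + j + 1)²`, so pairs are ordered first by their sum; injectivity
of `pair` follows. -/
theorem pair_lt_of_add_lt {i j i' j' : M} (h : i + j < i' + j') : pair i j < pair i' j' := by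
  obtain ⟨d, hd⟩ := exists_add_of_le (Order.add_one_le_iff.2 h)
  have h₁ : pair i' j' = pair i j + (j + (i + j) + 2 * d * (i + j + 1) + d * d + i') + 1 := by
    unfold pair; rw [hd]; ring
  rw [h₁, Order.lt_add_one_iff]
  exact le_add_of_nonneg_right zero_le

theorem pair_inj {i j i' j' : M} (h : pair i j = pair i' j') : i = i' ∧ j = j' := by
  rcases lt_trichotomy (i + j) (i' + j') with H | H | H
  · exact ((pair_lt_of_add_lt H).ne h).elim
  · have h₁ : i = i' := by unfold pair at h; rw [H] at h; exact add_left_cancel h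
    exact ⟨h₁, by subst h₁; exact add_left_cancel H⟩
  · exact ((pair_lt_of_add_lt H).ne' h).elim

theorem left_le_pair (i j : M) : i ≤ pair i j := le_add_of_nonneg_left zero_le

theorem right_le_pair (i j : M) : j ≤ pair i j := by
  rcases eq_zero_or_pos (i + j) with h | h
  · rw [(add_eq_zero.1 h).2]; exact zero_le
  · exact ((le_add_of_nonneg_left zero_le).trans (le_mul_of_pos h)).trans
      (le_add_of_nonneg_right zero_le)

theorem div_unique {d q r q' r' : M} (hr : r < d) (hr' : r' < d) (h : d * q + r = d * q' + r') :
    q = q' ∧ r = r' := by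
  have key : ∀ {q r q' r' : M}, r < d → d * q + r = d * q' + r' → q' ≤ q := by
    intro q r q' r' hr h
    by_contra! H
    obtain ⟨x, rfl⟩ := exists_add_of_le (Order.add_one_le_iff.2 H)
    have h₁ : r = d + (d * x + r') := by
      refine add_left_cancel (a := d * q) ?_
      rw [h]; ring
    exact hr.not_ge (h₁ ▸ le_add_of_nonneg_right zero_le)
  obtain rfl := le_antisymm (key hr' h.symm) (key hr h)
  exact ⟨rfl, add_left_cancel h⟩

instance D0.dvd (s t : (Fin n → M) → M) [IsTm s] [IsTm t] : D0 S (fun v => s v ∣ t v) := by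
  refine @D0.rel₂ _ _ _ _ _ _ (fun a b => a ∣ b) (D0.congr
    (Q := fun v => ∃ q, q ≤ v 1 ∧ v 1 = v 0 * q) fun v => ⟨?_, ?_⟩) s t _ _
  · rintro ⟨q, hq⟩
    rcases eq_zero_or_pos (v 0) with h | h
    · exact ⟨0, zero_le, by simpa [h] using hq⟩
    · exact ⟨q, by rw [hq, mul_comm]; exact le_mul_of_pos h, hq⟩
  · rintro ⟨q, -, hq⟩
    exact ⟨q, hq⟩

instance (priority := 1100) S1.dvd (s t : (Fin n → M) → M) [IsTm s] [IsTm t] :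
    S1 S (fun v => s v ∣ t v) :=
  inferInstance

instance D0.entry (s i x : (Fin n → M) → M) [IsTm s] [IsTm i] [IsTm x] :
    D0 S (fun v => Entry (s v) (i v) (x v)) := by
  refine @D0.rel₃ _ _ _ _ _ _ Entry (D0.congr (Q := fun v => ∃ a, a ≤ v 0 ∧ ∃ b, b ≤ v 0 ∧
    (v 0 = pair a b ∧ v 2 < b * (v 1 + 1) + 1 ∧ ∃ q, q ≤ a ∧ a = (b * (v 1 + 1) + 1) * q + v 2))
    fun v => ⟨?_, ?_⟩) s i x _ _ _
  · rintro ⟨a, b, hs, hx, q, hq⟩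
    refine ⟨a, hs ▸ left_le_pair a b, b, hs ▸ right_le_pair a b, hs, hx, q, ?_, hq⟩
    rw [hq, mul_comm]
    exact (le_mul_of_pos (Order.lt_add_one_iff.2 zero_le)).trans (le_add_of_nonneg_right zero_le)
  · rintro ⟨a, -, b, -, hs, hx, q, -, hq⟩
    exact ⟨a, b, hs, hx, q, hq⟩

theorem Entry.unique {s i v v' : M} (h : Entry s i v) (h' : Entry s i v') : v = v' := by
  obtain ⟨a, b, rfl, hv, q, hq⟩ := h
  obtain ⟨a', b', hs, hv', q', hq'⟩ := h'
  obtain ⟨rfl, rfl⟩ := pair_inj hs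
  exact (div_unique hv hv' (hq.symm.trans hq')).2

theorem Entry.le {s i v : M} (h : Entry s i v) : v ≤ s := by
  obtain ⟨a, b, rfl, hv, q, hq⟩ := h
  exact (hq ▸ le_add_of_nonneg_left zero_le).trans (left_le_pair a b)

/-! ### Coprimality and the Chinese remainder theorem -/

/-- `a` is invertible modulo `d`. -/
def Inv (a d : M) : Prop := ∃ u w w', u * a + w * d = w' * d + 1

instance S1.inv (a d : (Fin n → M) → M) [IsTm a] [IsTm d] : S1 S (fun v => Inv (a v) (d v)) := by
  have : S1 S (fun v : Fin 2 → M => Inv (v 0) (v 1)) := by unfold Inv; infer_instance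
  exact S1.comp (fun v : Fin 2 → M => Inv (v 0) (v 1))
    (fun w => Fin.cons (a w) (Fin.cons (d w) Fin.elim0))

theorem Inv.mul {a b d : M} (ha : Inv a d) (hb : Inv b d) : Inv (a * b) d := by
  obtain ⟨u, w, x, h⟩ := ha
  obtain ⟨u', w', x', h'⟩ := hb
  refine ⟨u * u', u * a * w' + u' * b * w + w * w' * d, x * x' * d + x + x', ?_⟩
  linear_combination (u' * b + w' * d) * h + (x * d + 1) * h'

/-- Without subtraction, a congruence modulo `d` is stated with multiples of `d` on both sides. As
`c < d`, the surplus cannot be on the left unless it vanishes. -/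
theorem exists_quotient {a d c w w' : M} (hc : c < d) (h : a + w * d = w' * d + c) :
    ∃ q, a = d * q + c := by
  rcases le_total w w' with H | H
  · obtain ⟨q, rfl⟩ := exists_add_of_le H
    exact ⟨q, by refine add_right_cancel (b := w * d) ?_; rw [h]; ring⟩
  · obtain ⟨q, rfl⟩ := exists_add_of_le H
    have h₁ : a + q * d = c := by refine add_right_cancel (b := w' * d) ?_; linear_combination h
    rcases eq_zero_or_pos q with rfl | hq
    · exact ⟨0, by simpa using h₁⟩
    · have h₂ : d ≤ c := by
        rw [← h₁, mul_comm]; exact (le_mul_of_pos hq).trans (le_add_of_nonneg_left zero_le)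
      exact (hc.not_ge h₂).elim

theorem Inv.not_dvd {a d : M} (h : Inv a d) (hd : 1 < d) : ¬ d ∣ a := by
  rintro ⟨q, rfl⟩
  obtain ⟨u, w, w', h⟩ := h
  have := div_unique (d := d) (q := u * q + w) (q' := w') (zero_le.trans_lt hd) hd
    (by linear_combination h)
  exact zero_ne_one this.2

/-- The moduli of the beta function differ by `m * x` with `x` dividing `m`. Modulo `m * (j + 1) +
1` both `m` and its divisor `x` are invertible. -/
theorem inv_modulus {m i j k : M} (hij : i ≠ j) (hi : i < k) (hj : j < k)
    (hm : ∀ x, 0 < x → x ≤ k → x ∣ m) : Inv (m * (i + 1) + 1) (m * (j + 1) + 1) := by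
  rcases hij.lt_or_gt with h | h
  · obtain ⟨x, rfl⟩ := exists_add_of_le h.le
    obtain ⟨y, hy⟩ := hm x (pos_of_lt_add_right h) (le_add_self.trans hj.le)
    -- Modulo the larger modulus, the smaller one is `-m * x`, with inverse `-y * (i + x + 1)²`; the
    -- sign is replaced by the factor `m * (i + x + 1)`, which is congruent to `-1`.
    exact ⟨y * (i + x + 1) ^ 2 * (m * (i + x + 1)), (m * (i + x + 1)) ^ 2 + 1,
      y * (i + x + 1) ^ 2 * (m * (i + x + 1)) + m * (i + x + 1), by
        linear_combination (m * (i + x + 1) ^ 2 * (m * (i + x + 1))) * hy⟩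
  · obtain ⟨x, rfl⟩ := exists_add_of_le h.le
    obtain ⟨y, hy⟩ := hm x (pos_of_lt_add_right h) (le_add_self.trans hi.le)
    -- Here the residue is `m * x`, and `m * x * y * (j + 1)² = (m * (j + 1))²` is congruent to `1`.
    exact ⟨y * (j + 1) ^ 2, 1, y * (j + 1) ^ 2 + m * (j + 1), by
      linear_combination (m * (j + 1) ^ 2) * hy.symm⟩

end Arithmetic

/-! ### Coded sequences, the pigeonhole principle and strings -/

section Sequences

variable {M : Type u} [CommSemiring M] [LinearOrder M] [IsStrictOrderedRing M]
  [CanonicallyOrderedAdd M] [SuccAddOrder M] {S : Set (Set M)} {n : ℕ}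

theorem S1.rel₂ (R : M → M → Prop)
    [S1 S (fun v : Fin 2 → M => R (v 0) (v 1))] (s t : (Fin n → M) → M) [IsTm s] [IsTm t] :
    S1 S (fun v => R (s v) (t v)) :=
  S1.comp (S := S) (fun v : Fin 2 → M => R (v 0) (v 1))
    (fun w => Fin.cons (s w) (Fin.cons (t w) Fin.elim0))

theorem D0.rel₁ (R : M → Prop)
    [D0 S (fun v : Fin 1 → M => R (v 0))] (s : (Fin n → M) → M) [IsTm s] :
    D0 S (fun v => R (s v)) :=
  D0.comp (S := S) (fun v : Fin 1 → M => R (v 0)) (fun w => Fin.cons (s w) Fin.elim0)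

/-- Replaces a factorial; `b ≤ m` leaves room for remainders up to `b`. -/
theorem exists_common_multiple (S : Set (Set M)) [Fact (RCA0 S)] (b k : M) :
    ∃ m, b ≤ m ∧ 0 < m ∧ ∀ x, 0 < x → x ≤ k → x ∣ m := by
  refine (sig_induction S (fun k => ∃ m, b ≤ m ∧ 0 < m ∧ ∀ x, x ≤ k → 0 < x → x ∣ m) ?_ ?_) k |>.imp
    fun m h => ⟨h.1, h.2.1, fun x h1 h2 => h.2.2 x h2 h1⟩
  · exact ⟨b + 1, le_self_add, Order.lt_add_one_iff.2 zero_le, fun x h h' => (h'.not_ge h).elim⟩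
  · rintro k ⟨m, hb, hm, h⟩
    refine ⟨m * (k + 1), hb.trans (le_mul_of_pos (Order.lt_add_one_iff.2 zero_le)),
      mul_pos hm (Order.lt_add_one_iff.2 zero_le), fun x hx h0 => ?_⟩
    rcases hx.lt_or_eq with hx | rfl
    · exact (h x (Order.lt_add_one_iff.1 hx) h0).mul_right _
    · exact dvd_mul_left _ _

theorem lt_modulus {c m i : M} (h : c ≤ m) : c < m * (i + 1) + 1 :=
  Order.lt_add_one_iff.2 (h.trans (le_mul_of_pos (Order.lt_add_one_iff.2 zero_le)))

/-- The Chinese remainder theorem. -/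
theorem exists_remainders [Fact (RCA0 S)] (G : M → M → Prop)
    {k m : M} (hm : ∀ x, 0 < x → x ≤ k → x ∣ m)
    (hG : ∀ i, i < k → ∃ c, c ≤ m ∧ G i c)
    (_ : S1 S (fun v : Fin 2 → M => G (v 0) (v 1)) := by infer_instance) :
    ∃ A, ∀ i, i < k → ∃ c, G i c ∧ c ≤ m ∧ ∃ q, A = (m * (i + 1) + 1) * q + c := by
  -- In the induction that follows, `N` is a multiple of the moduli already treated and invertible
  -- modulo each later one.
  have hG' := fun {n : ℕ} (s t : (Fin n → M) → M) [IsTm s] [IsTm t] => S1.rel₂ (S := S) G s t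
  obtain ⟨A, N, h, -⟩ := (sig_induction S (fun j => j ≤ k → ∃ A N : M,
    (∀ i, i < j → ∃ c, G i c ∧ c ≤ m ∧ ∃ q, A = (m * (i + 1) + 1) * q + c) ∧
    (∀ i, i < j → m * (i + 1) + 1 ∣ N) ∧
    (∀ i, i < k → j ≤ i → Inv N (m * (i + 1) + 1)))
    (fun _ => ⟨0, 1, by simp, by simp, fun i _ _ => ⟨1, 0, 0, by ring⟩⟩)
    (fun j ih hj => by
      obtain ⟨A, N, h₁, h₂, h₃⟩ := ih (le_self_add.trans hj)
      have hjk := Order.add_one_le_iff.1 hj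
      obtain ⟨c, hc, hGc⟩ := hG j hjk
      obtain ⟨u, w, w', hu⟩ := h₃ j hjk le_rfl
      -- Adding a multiple of `N` preserves the earlier remainders. Since `u * N` is congruent to
      -- `1` and `m * (j + 1)` to `-1`, the correction is congruent to `c - A`.
      refine ⟨A + N * (u * (c + A * (m * (j + 1)))), N * (m * (j + 1) + 1), fun i hi => ?_,
        fun i hi => ?_, fun i hi hji => ?_⟩
      · rcases (Order.lt_add_one_iff.1 hi).lt_or_eq with hi | rfl
        · obtain ⟨d, hd, hdm, q, rfl⟩ := h₁ i hi
          obtain ⟨r, rfl⟩ := h₂ i hi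
          exact ⟨d, hd, hdm, q + r * (u * (c + ((m * (i + 1) + 1) * q + d) * (m * (j + 1)))), by ring⟩
        · refine ⟨c, hGc, hc, exists_quotient (lt_modulus hc)
            (w := w * (c + A * (m * (i + 1)))) (w' := w' * (c + A * (m * (i + 1))) + A) ?_⟩
          linear_combination (c + A * (m * (i + 1))) * hu
      · rcases (Order.lt_add_one_iff.1 hi).lt_or_eq with hi | rfl
        · exact (h₂ i hi).mul_right _
        · exact dvd_mul_left _ _
      · have hji := Order.add_one_le_iff.1 hji
        exact (h₃ i hi hji.le).mul (inv_modulus hji.ne hjk hi hm))) k le_rfl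
  exact ⟨A, h⟩

/-- A bounded `Σ⁰₁` relation has a coded choice sequence. -/
theorem exists_seq [Fact (RCA0 S)] (G : M → M → Prop)
    (k b : M)
    (hG : ∀ i, i < k → ∃ c, c ≤ b ∧ G i c)
    (_ : S1 S (fun v : Fin 2 → M => G (v 0) (v 1)) := by infer_instance) :
    ∃ s, ∀ i, i < k → ∃ c, G i c ∧ Entry s i c := by
  obtain ⟨m, hb, hm, hd⟩ := exists_common_multiple S b k
  obtain ⟨A, hA⟩ := exists_remainders (S := S) G hd fun i hi =>
    (hG i hi).imp fun c hc => ⟨hc.1.trans hb, hc.2⟩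
  refine ⟨pair A m, fun i hi => ?_⟩
  obtain ⟨c, hc, hcm, q, hq⟩ := hA i hi
  exact ⟨c, hc, A, m, rfl, lt_modulus hcm, q, hq⟩

theorem exists_seq_append (S : Set (Set M)) [Fact (RCA0 S)] (s k a : M)
    (hs : ∀ i, i < k → ∃ v, Entry s i v) :
    ∃ s', (∀ i, i < k → ∃ v, Entry s i v ∧ Entry s' i v) ∧ Entry s' k a := by
  obtain ⟨s', h⟩ := exists_seq (S := S)
    (fun i c => (i < k ∧ Entry s i c) ∨ (i = k ∧ c = a)) (k + 1) (max s a) (fun i hi => by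
      rcases (Order.lt_add_one_iff.1 hi).lt_or_eq with hi | rfl
      · obtain ⟨v, hv⟩ := hs i hi
        exact ⟨v, le_max_of_le_left hv.le, .inl ⟨hi, hv⟩⟩
      · exact ⟨a, le_max_right _ _, .inr ⟨rfl, rfl⟩⟩)
  refine ⟨s', fun i hi => ?_, ?_⟩
  · obtain ⟨c, ⟨-, h⟩ | ⟨rfl, -⟩, h'⟩ := h i (hi.trans (Order.lt_add_one_iff.2 le_rfl))
    · exact ⟨c, h, h'⟩
    · exact (lt_irrefl _ hi).elim
  · obtain ⟨c, ⟨h, -⟩ | ⟨-, rfl⟩, h'⟩ := h k (Order.lt_add_one_iff.2 le_rfl)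
    · exact (lt_irrefl _ h).elim
    · exact h'

/-- The pigeonhole principle for coded sequences. -/
theorem pigeonhole (S : Set (Set M)) [Fact (RCA0 S)] {u y k : M}
    (hu : ∀ j, j < k → ∃ v, Entry u j v) (hy : ∀ i, i ≤ k → ∃ v, Entry y i v)
    (inj : ∀ i j v, i ≤ k → j ≤ k → Entry y i v → Entry y j v → i = j) :
    ∃ i v, i ≤ k ∧ Entry y i v ∧ ∀ j, j < k → ¬ Entry u j v := by
  by_contra! H
  -- Exchange argument: `u'` keeps all values of `u` while its first `c` entries become those of
  -- `y`. At `c = k` there is no place left for entry `k` of `y`.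
  obtain ⟨u', h₁, h₂, -⟩ := (sig_induction S (fun c => c ≤ k → ∃ u',
    (∀ j, j < k → ∀ v, v ≤ u → Entry u j v → ∃ i, i < k ∧ Entry u' i v) ∧
    (∀ i, i < c → ∃ v, Entry y i v ∧ Entry u' i v) ∧ (∀ j, j < k → ∃ v, Entry u' j v))
    (fun _ => ⟨u, fun j hj v _ h => ⟨j, hj, h⟩, by simp, hu⟩)
    (fun c ih hck => by
      obtain ⟨u', h₁, h₂, h₃⟩ := ih (le_self_add.trans hck)
      have hck := Order.add_one_le_iff.1 hck
      obtain ⟨v, hv⟩ := hy c hck.le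
      obtain ⟨j, hj, hjv⟩ := H c v hck.le hv
      obtain ⟨j', hj', hj'v⟩ := h₁ j hj v hjv.le hjv
      obtain ⟨w, hw⟩ := h₃ c hck
      have hcj : c ≤ j' := by
        by_contra! hlt
        obtain ⟨x, hx, hx'⟩ := h₂ j' hlt
        obtain rfl := hx'.unique hj'v
        exact hlt.ne (inj _ _ _ hj'.le hck.le hx hv)
      -- Entries `c` and `j'` of `u'` are swapped; if `c = j'`, nothing changes.
      obtain ⟨s, hs⟩ := exists_seq (S := S) (fun i x => (i = c ∧ x = v) ∨
        (i = j' ∧ i ≠ c ∧ x = w) ∨ (i ≠ c ∧ i ≠ j' ∧ Entry u' i x)) k u' (fun i hi => by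
          by_cases hic : i = c
          · exact ⟨v, hj'v.le, .inl ⟨hic, rfl⟩⟩
          · by_cases hij : i = j'
            · exact ⟨w, hw.le, .inr (.inl ⟨hij, hic, rfl⟩)⟩
            · obtain ⟨x, hx⟩ := h₃ i hi
              exact ⟨x, hx.le, .inr (.inr ⟨hic, hij, hx⟩)⟩)
      have hsc : Entry s c v := by
        obtain ⟨x, hx, hx'⟩ := hs c hck
        grind
      refine ⟨s, fun i hi x hx hix => ?_, fun i hi => ?_, fun i hi => ?_⟩
      · obtain ⟨i', hi', h'⟩ := h₁ i hi x hx hix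
        by_cases hic : i' = c
        · subst hic
          obtain rfl := h'.unique hw
          by_cases hij : i' = j'
          · subst hij
            obtain rfl := h'.unique hj'v
            exact ⟨i', hi', hsc⟩
          · obtain ⟨z, hz, hz'⟩ := hs j' hj'
            refine ⟨j', hj', ?_⟩
            grind
        · by_cases hij : i' = j'
          · subst hij
            obtain rfl := h'.unique hj'v
            exact ⟨c, hck, hsc⟩
          · obtain ⟨z, hz, hz'⟩ := hs i' hi'
            have : Entry u' i' z := by grind
            obtain rfl := this.unique h'
            exact ⟨i', hi', hz'⟩
      · rcases (Order.lt_add_one_iff.1 hi).lt_or_eq with hi | rfl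
        · obtain ⟨x, hx, hx'⟩ := h₂ i hi
          obtain ⟨z, hz, hz'⟩ := hs i (hi.trans hck)
          have : Entry u' i z := by grind
          obtain rfl := this.unique hx'
          exact ⟨z, hx, hz'⟩
        · exact ⟨v, hv, hsc⟩
      · obtain ⟨z, -, hz⟩ := hs i hi
        exact ⟨z, hz⟩)) k le_rfl
  obtain ⟨v, hv⟩ := hy k le_rfl
  obtain ⟨j, hj, hjv⟩ := H k v le_rfl hv
  obtain ⟨i, hi, hiv⟩ := h₁ j hj v hjv.le hjv
  obtain ⟨x, hx, hx'⟩ := h₂ i hi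
  obtain rfl := hx'.unique hiv
  exact hi.ne (inj _ _ _ hi.le le_rfl hx hv)

/-! ### Binary strings -/

theorem len_pair {l m p k : M} : Len (pair l (pair m p)) k ↔ k = l := by
  constructor
  · rintro ⟨m', p', h⟩
    exact (pair_inj h).1.symm
  · rintro rfl
    exact ⟨m, p, rfl⟩

theorem Len.unique {σ k l : M} (h : Len σ k) (h' : Len σ l) : k = l := by
  obtain ⟨m, p, rfl⟩ := h
  exact (len_pair.1 h').symm

theorem Len.le {σ l : M} (h : Len σ l) : l ≤ σ := by
  obtain ⟨m, p, rfl⟩ := h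
  exact left_le_pair _ _

theorem isOne_pair {l m p x : M} :
    IsOne (pair l (pair m p)) x ↔ x < l ∧ m * (x + 1) + 1 ∣ p := by
  constructor
  · rintro ⟨l', m', p', h, hx, hd⟩
    obtain ⟨rfl, h'⟩ := pair_inj h
    obtain ⟨rfl, rfl⟩ := pair_inj h'
    exact ⟨hx, hd⟩
  · rintro ⟨hx, hd⟩
    exact ⟨l, m, p, rfl, hx, hd⟩

instance D0.len (s l : (Fin n → M) → M) [IsTm s] [IsTm l] : D0 S (fun v => Len (s v) (l v)) := by
  refine @D0.rel₂ _ _ _ _ _ _ Len (D0.congr (Q := fun v => ∃ m, m ≤ v 0 ∧ ∃ p, p ≤ v 0 ∧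
    v 0 = pair (v 1) (pair m p)) fun v => ⟨?_, ?_⟩) s l _ _
  · rintro ⟨m, p, h⟩
    exact ⟨m, h ▸ (left_le_pair _ _).trans (right_le_pair _ _), p,
      h ▸ (right_le_pair _ _).trans (right_le_pair _ _), h⟩
  · rintro ⟨m, -, p, -, h⟩
    exact ⟨m, p, h⟩

instance D0.isOne (s x : (Fin n → M) → M) [IsTm s] [IsTm x] :
    D0 S (fun v => IsOne (s v) (x v)) := by
  refine @D0.rel₂ _ _ _ _ _ _ IsOne (D0.congr (Q := fun v => ∃ l, l ≤ v 0 ∧ ∃ m, m ≤ v 0 ∧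
    ∃ p, p ≤ v 0 ∧ (v 0 = pair l (pair m p) ∧ v 1 < l ∧ m * (v 1 + 1) + 1 ∣ p))
    fun v => ⟨?_, ?_⟩) s x _ _
  · rintro ⟨l, m, p, h, hx⟩
    exact ⟨l, h ▸ left_le_pair _ _, m, h ▸ (left_le_pair _ _).trans (right_le_pair _ _), p,
      h ▸ (right_le_pair _ _).trans (right_le_pair _ _), h, hx⟩
  · rintro ⟨l, -, m, -, p, -, h, hx⟩
    exact ⟨l, m, p, h, hx⟩

instance D0.isPrefix (s t : (Fin n → M) → M) [IsTm s] [IsTm t] :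
    D0 S (fun v => IsPrefix (s v) (t v)) := by
  refine @D0.rel₂ _ _ _ _ _ _ IsPrefix (D0.congr (Q := fun v => ∃ k, k ≤ v 0 ∧ ∃ l, l ≤ v 1 ∧
    (Len (v 0) k ∧ Len (v 1) l ∧ ¬ l < k ∧ ∀ x, x < k → (IsOne (v 0) x ↔ IsOne (v 1) x)))
    fun v => ⟨?_, ?_⟩) s t _ _
  · rintro ⟨k, l, hk, hl, h⟩
    exact ⟨k, hk.le, l, hl.le, hk, hl, h⟩
  · rintro ⟨k, -, l, -, h⟩
    exact ⟨k, l, h⟩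

instance D0.isString (s : (Fin n → M) → M) [IsTm s] : D0 S (fun v => IsString (s v)) := by
  refine @D0.rel₁ _ _ _ _ _ _ _ _ IsString (D0.congr (Q := fun v => (∃ l, l ≤ v 0 ∧ Len (v 0) l) ∧
    ∀ t, t < v 0 → ¬ (IsPrefix t (v 0) ∧ IsPrefix (v 0) t)) fun v => ?_) s _
  refine and_congr_left fun _ => ⟨?_, ?_⟩
  · rintro ⟨l, h⟩
    exact ⟨l, h.le, h⟩
  · rintro ⟨l, -, h⟩
    exact ⟨l, h⟩

theorem IsPrefix.trans {ρ σ τ : M} (h : IsPrefix ρ σ) (h' : IsPrefix σ τ) : IsPrefix ρ τ := by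
  obtain ⟨k, l, hk, hl, hkl, h⟩ := h
  obtain ⟨l', j, hl', hj, hlj, h'⟩ := h'
  obtain rfl := hl.unique hl'
  rw [not_lt] at hkl hlj
  exact ⟨k, j, hk, hj, (hkl.trans hlj).not_gt, fun x hx => (h x hx).trans (h' x (hx.trans_le hkl))⟩

/-- Every bounded set is coded by a string. -/
theorem exists_string [Fact (RCA0 S)] (A : M → Prop) (l : M)
    (_ : D0 S (fun v : Fin 1 → M => A (v 0)) := by infer_instance) :
    ∃ σ, IsString σ ∧ Len σ l ∧ ∀ x, x < l → (IsOne σ x ↔ A x) := by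
  have hA := fun {n : ℕ} (s : (Fin n → M) → M) [IsTm s] => D0.rel₁ (S := S) A s
  obtain ⟨m, -, hm0, hm⟩ := exists_common_multiple S 0 l
  -- Invertibility at the positions outside `A` is the form of non-divisibility that survives
  -- multiplication by the other moduli.
  obtain ⟨N, hN⟩ := (sig_induction S (fun j => j ≤ l → ∃ N : M, ∀ x, x < l →
      (x < j ∧ A x → m * (x + 1) + 1 ∣ N) ∧ (¬ (x < j ∧ A x) → Inv N (m * (x + 1) + 1)))
    (fun _ => ⟨1, fun x _ => ⟨by simp, fun _ => ⟨1, 0, 0, by ring⟩⟩⟩)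
    (fun j ih hj => by
      obtain ⟨N, h⟩ := ih (le_self_add.trans hj)
      have hj := Order.add_one_le_iff.1 hj
      by_cases hAj : A j
      · refine ⟨N * (m * (j + 1) + 1), fun x hx => ⟨fun ⟨hxj, hAx⟩ => ?_, fun H => ?_⟩⟩
        · rcases (Order.lt_add_one_iff.1 hxj).lt_or_eq with hxj | rfl
          · exact ((h x hx).1 ⟨hxj, hAx⟩).mul_right _
          · exact dvd_mul_left _ _
        · have hne : j ≠ x := by rintro rfl; exact H ⟨Order.lt_add_one_iff.2 le_rfl, hAj⟩
          exact ((h x hx).2 fun h' => H ⟨h'.1.trans (Order.lt_add_one_iff.2 le_rfl), h'.2⟩).mul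
            (inv_modulus hne hj hx hm)
      · refine ⟨N, fun x hx => ⟨fun ⟨hxj, hAx⟩ => ?_, fun H => (h x hx).2 fun h' =>
          H ⟨h'.1.trans (Order.lt_add_one_iff.2 le_rfl), h'.2⟩⟩⟩
        rcases (Order.lt_add_one_iff.1 hxj).lt_or_eq with hxj | rfl
        · exact (h x hx).1 ⟨hxj, hAx⟩
        · exact (hAj hAx).elim)) l le_rfl
  have hone : ∀ x, x < l → (IsOne (pair l (pair m N)) x ↔ A x) := by
    intro x hx
    rw [isOne_pair]
    refine ⟨fun ⟨_, hd⟩ => ?_, fun hAx => ⟨hx, (hN x hx).1 ⟨hx, hAx⟩⟩⟩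
    by_contra hAx
    refine ((hN x hx).2 fun h => hAx h.2).not_dvd ?_ hd
    exact lt_add_of_pos_left _ (mul_pos hm0 (Order.lt_add_one_iff.2 zero_le))
  have hrefl : ∀ {σ}, Len σ l → IsPrefix σ σ := fun h => ⟨l, l, h, h, lt_irrefl _, fun _ _ => .rfl⟩
  -- Passing to the least code of the same string is what `IsString` demands.
  obtain ⟨σ, ⟨h₁, h₂⟩, hmin⟩ := exists_least S
    (fun τ => IsPrefix τ (pair l (pair m N)) ∧ IsPrefix (pair l (pair m N)) τ)
    (a := pair l (pair m N)) ⟨hrefl (len_pair.2 rfl), hrefl (len_pair.2 rfl)⟩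
  have ⟨k, l', hk, hl', hkl, h⟩ := h₁
  have ⟨l'', k', hl'', hk', hlk, _⟩ := h₂
  obtain rfl := len_pair.1 hl'
  obtain rfl := len_pair.1 hl''
  obtain rfl := hk.unique hk'
  obtain rfl := le_antisymm (not_lt.1 hkl) (not_lt.1 hlk)
  refine ⟨σ, ⟨⟨k, hk⟩, fun τ hτ H => hmin τ hτ ⟨H.1.trans h₁, h₂.trans H.2⟩⟩, hk,
    fun x hx => (h x hx).trans (hone x hx)⟩

end Sequences

/-! ### Complexity and determinism of computations -/

section Computation

variable {M : Type u} [CommSemiring M] [LinearOrder M] [IsStrictOrderedRing M]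
  [CanonicallyOrderedAdd M] [SuccAddOrder M] {S : Set (Set M)}

/-- All universal quantifiers in a computation are bounded, and collection moves them past the
existential ones; the oracle is a set parameter. -/
theorem S1.phi [Fact (RCA0 S)] (X : Set M) [Fact (X ∈ S)] :
    S1 S (fun v : Fin 2 → M => Phi X (v 0) (v 0) (v 1)) := by
  unfold Phi Step Instr Effect Halted
  infer_instance

theorem Instr.unique {e i op r j op' r' j' : M} (h : Instr e i op r j) (h' : Instr e i op' r' j') :
    op = op' ∧ r = r' ∧ j = j' := by
  obtain ⟨k, s, rfl, -, h⟩ := h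
  obtain ⟨k', s', hk, -, h'⟩ := h'
  obtain ⟨rfl, rfl⟩ := pair_inj hk
  obtain ⟨h₁, h₂⟩ := pair_inj (h.unique h')
  exact ⟨h₁, pair_inj h₂⟩

theorem Halted.not_instr {e i op r j : M} (h : Halted e i) : ¬ Instr e i op r j := by
  rintro ⟨k, s, rfl, hi, -⟩
  obtain ⟨k', s', hk, hi'⟩ := h
  exact hi' ((pair_inj hk).1 ▸ hi)

theorem Effect.unique {X : Set M} {op j i v i₁ v₁ i₂ v₂ : M} (h : Effect X op j i v i₁ v₁)
    (h' : Effect X op j i v i₂ v₂) : i₁ = i₂ ∧ v₁ = v₂ := by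
  have h₀ : ∀ a : M, a + 1 ≠ 0 := fun a => (Order.lt_add_one_iff.2 zero_le).ne'
  have h₁ : (1 : M) ≠ 0 := one_ne_zero
  have h₂ : (1 : M) + 1 ≠ 1 := (lt_add_of_pos_left _ one_pos).ne'
  have h₃ := h₀ 1
  unfold Effect at h h'
  rcases h with ⟨rfl, ha, hb⟩ | ⟨rfl, ⟨ha, hb, hc⟩ | ⟨ha, hb⟩⟩ | ⟨rfl, ha, ⟨hb, hc⟩ | ⟨hb, hc⟩⟩ <;>
  rcases h' with ⟨hz, ha', hb'⟩ | ⟨hz, ⟨ha', hb', hc'⟩ | ⟨ha', hb'⟩⟩ |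
    ⟨hz, ha', ⟨hb', hc'⟩ | ⟨hb', hc'⟩⟩ <;>
  first
    | exact (h₁ hz.symm).elim | exact (h₁ hz).elim | exact (h₂ hz.symm).elim | exact (h₂ hz).elim
    | exact (h₃ hz.symm).elim | exact (h₃ hz).elim | exact (hb hb').elim | exact (hb' hb).elim
    | exact (h₀ _ (ha.symm.trans ha')).elim | exact (h₀ _ (ha'.symm.trans ha)).elim
    | exact ⟨hc.trans hc'.symm, hb.trans hb'.symm⟩ | exact ⟨hc.trans hc'.symm, ha.trans ha'.symm⟩
    | exact ⟨ha.trans ha'.symm, hb.trans hb'.symm⟩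
    | exact ⟨hb.trans hb'.symm, add_right_cancel (ha.symm.trans ha')⟩

/-- Computations are deterministic. -/
theorem Phi.unique [Fact (RCA0 S)] {X : Set M} {e x y y' : M} (h : Phi X e x y)
    (h' : Phi X e x y') : y = y' := by
  obtain ⟨t, w, p, h, hw, hp, hx, hr, hs, ⟨i, hi, hH⟩, hy⟩ := h
  obtain ⟨t', w', p', h', hw', hp', hx', hr', hs', ⟨i', hi', hH'⟩, hy'⟩ := h'
  -- The two histories may have different register bounds, so they are compared only on registers
  -- below both; the register acted upon is always among these.
  have key := sig_induction S (fun s => s ≤ t → s ≤ t' → (∃ i, Entry p s i ∧ Entry p' s i) ∧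
      ∀ r, r < w → r < w' → ∃ v, Entry h (pair s r) v ∧ Entry h' (pair s r) v)
    (fun _ _ => ⟨⟨0, hp, hp'⟩, fun r h₁ h₂ => by
      rcases eq_or_ne r 0 with rfl | h₀
      · exact ⟨x, hx, hx'⟩
      · exact ⟨0, hr r h₁ h₀, hr' r h₂ h₀⟩⟩)
    (fun s ih hst hst' => by
      obtain ⟨⟨i, h₁, h₁'⟩, h₂⟩ := ih (le_self_add.trans hst) (le_self_add.trans hst')
      obtain ⟨op, r, j, a, b, v, z, q₁, q₂, q₃, q₄, q₅, q₆, q₇, q₈⟩ :=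
        hs s (Order.add_one_le_iff.1 hst)
      obtain ⟨op', r', j', a', b', v', z', q₁', q₂', q₃', q₄', q₅', q₆', q₇', q₈'⟩ :=
        hs' s (Order.add_one_le_iff.1 hst')
      obtain rfl := h₁.unique q₁
      obtain rfl := h₁'.unique q₁'
      obtain ⟨rfl, rfl, rfl⟩ := q₃.unique q₃'
      obtain ⟨v₀, h₃, h₃'⟩ := h₂ r q₄ q₄'
      obtain rfl := h₃.unique q₅
      obtain rfl := h₃'.unique q₅'
      obtain ⟨rfl, rfl⟩ := q₇.unique q₇'
      refine ⟨⟨b, q₂, q₂'⟩, fun r₀ hr₀ hr₀' => ?_⟩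
      rcases eq_or_ne r₀ r with rfl | hne
      · exact ⟨z, q₆, q₆'⟩
      · obtain ⟨c, hc, hc'⟩ := q₈ r₀ hr₀ hne
        obtain ⟨d, hd, hd'⟩ := q₈' r₀ hr₀' hne
        obtain ⟨g, hg, hg'⟩ := h₂ r₀ hr₀ hr₀'
        obtain rfl := hc.unique hg
        obtain rfl := hd.unique hg'
        exact ⟨_, hc', hd'⟩)
  -- The run that halts first would, at that address, still have an instruction according to the
  -- other run.
  obtain rfl : t = t' := by
    rcases lt_trichotomy t t' with H | H | H
    · obtain ⟨⟨a, ha, ha'⟩, -⟩ := key t le_rfl H.le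
      obtain ⟨op, r, j, b, -, -, -, hb, -, hI, -⟩ := hs' t H
      obtain rfl := ha.unique hi
      obtain rfl := ha'.unique hb
      exact (hH.not_instr hI).elim
    · exact H
    · obtain ⟨⟨a, ha, ha'⟩, -⟩ := key t' H.le le_rfl
      obtain ⟨op, r, j, b, -, -, -, hb, -, hI, -⟩ := hs t' H
      obtain rfl := ha'.unique hi'
      obtain rfl := ha.unique hb
      exact (hH'.not_instr hI).elim
  obtain ⟨-, h₂⟩ := key t le_rfl le_rfl
  obtain ⟨v, hv, hv'⟩ := h₂ 0 hw hw'
  exact (hy.unique hv).trans (hv'.unique hy')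

end Computation

/-! ### The splitting tree and the diagonal function -/

section Diagonalization

variable {M : Type u} [CommSemiring M] [LinearOrder M] [IsStrictOrderedRing M]
  [CanonicallyOrderedAdd M] [SuccAddOrder M] {S : Set (Set M)} {n : ℕ}

/-- `y` codes a sequence of length at least `k` whose first `k` entries are distinct. -/
def InjSeq (y k : M) : Prop :=
  (∀ i, i < k → ∃ v, v ≤ y ∧ Entry y i v) ∧
    ∀ i, i < k → ∀ j, j < k → ∀ v, v ≤ y → Entry y i v → Entry y j v → i = j

instance D0.injSeq (s t : (Fin n → M) → M) [IsTm s] [IsTm t] :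
    D0 S (fun v => InjSeq (s v) (t v)) := by
  have : D0 S (fun v : Fin 2 → M => InjSeq (v 0) (v 1)) := by unfold InjSeq; infer_instance
  exact D0.rel₂ InjSeq s t

theorem InjSeq.append (S : Set (Set M)) [Fact (RCA0 S)] {u k a : M} (h : InjSeq u k)
    (ha : ∀ i, i < k → ¬ Entry u i a) : ∃ u', InjSeq u' (k + 1) ∧
      (∀ i, i < k → ∀ v, Entry u i v → Entry u' i v) ∧ Entry u' k a := by
  obtain ⟨u', h₁, h₂⟩ := exists_seq_append S u k a fun i hi => (h.1 i hi).imp fun _ h => h.2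
  have h₃ : ∀ i, i < k → ∀ v, Entry u' i v → Entry u i v := fun i hi v hv => by
    obtain ⟨w, hw, hw'⟩ := h₁ i hi
    exact hw'.unique hv ▸ hw
  refine ⟨u', ⟨fun i hi => ?_, fun i hi j hj v _ hiv hjv => ?_⟩, fun i hi v hv => ?_, h₂⟩
  · rcases (Order.lt_add_one_iff.1 hi).lt_or_eq with hi | rfl
    · obtain ⟨v, -, hv⟩ := h₁ i hi
      exact ⟨v, hv.le, hv⟩
    · exact ⟨a, h₂.le, h₂⟩
  · rcases (Order.lt_add_one_iff.1 hi).lt_or_eq with hi | rfl <;>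
      rcases (Order.lt_add_one_iff.1 hj).lt_or_eq with hj | rfl
    · have hv := h₃ i hi v hiv
      exact h.2 i hi j hj v hv.le hv (h₃ j hj v hjv)
    · exact (ha i hi (hjv.unique h₂ ▸ h₃ i hi v hiv)).elim
    · exact (ha j hj (hiv.unique h₂ ▸ h₃ j hj v hjv)).elim
    · rfl
  · obtain ⟨w, hw, hw'⟩ := h₁ i hi
    exact hw.unique hv ▸ hw'

/-- The pigeonhole principle for the first `k + 1` entries of `y`; it supplies the numbers to be
reserved. -/
theorem InjSeq.exists_fresh (S : Set (Set M)) [Fact (RCA0 S)] {u y k l : M} (hu : InjSeq u k)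
    (hy : InjSeq y l) (hkl : k < l) : ∃ i v, i < l ∧ Entry y i v ∧ ∀ j, j < k → ¬ Entry u j v := by
  obtain ⟨i, v, hi, h⟩ := pigeonhole S (fun j hj => (hu.1 j hj).imp fun _ h => h.2)
    (fun i (hi : i ≤ k) => (hy.1 i (hi.trans_lt hkl)).imp fun _ h => h.2)
    (fun i j v hi hj h₁ h₂ => hy.2 i (hi.trans_lt hkl) j (hj.trans_lt hkl) v h₁.le h₁ h₂)
  exact ⟨i, v, hi.trans_lt hkl, h⟩

theorem add_self_add_one_lt {d e : M} (h : d < e) : d + d + 1 < e + e := by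
  rw [add_assoc]
  exact add_lt_add_of_lt_of_le h (Order.add_one_le_iff.2 h)

theorem add_self_ne_add_self_add_one (d e : M) : e + e ≠ d + d + 1 := by
  rcases le_or_gt e d with h | h
  · exact (Order.lt_add_one_iff.2 (add_le_add h h)).ne
  · exact (add_self_add_one_lt h).ne'

/-- An unbounded set contains long sequences. -/
theorem exists_injSeq_mem [Fact (RCA0 S)] {H : Set M} [Fact (H ∈ S)] (hH : Unbounded H) (k : M) :
    ∃ y, InjSeq y k ∧ ∀ i, i < k → ∃ v, v ≤ y ∧ Entry y i v ∧ v ∈ H := by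
  refine (sig_induction S (fun k => ∃ y, InjSeq y k ∧
    ∀ i, i < k → ∃ v, v ≤ y ∧ Entry y i v ∧ v ∈ H) ⟨0, by simp [InjSeq], by simp⟩ ?_) k
  rintro k ⟨y, hy, h⟩
  -- Entries never exceed the code, so an element of `H` above `y` is new.
  obtain ⟨a, ha, hya⟩ := hH y
  obtain ⟨y', h₁, h₂, h₃⟩ := hy.append S (a := a) fun i _ h => hya.not_ge h.le
  refine ⟨y', h₁, fun i hi => ?_⟩
  rcases (Order.lt_add_one_iff.1 hi).lt_or_eq with hi | rfl
  · obtain ⟨v, -, hv, hvH⟩ := h i hi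
    exact ⟨v, (h₂ i hi v hv).le, h₂ i hi v hv, hvH⟩
  · exact ⟨a, h₃.le, h₃, ha⟩

/-- The string `σ` is not constant on the first `k` entries of `y`. -/
def Splits (σ y k : M) : Prop :=
  (∃ i, i < k ∧ ∃ v, v ≤ y ∧ (Entry y i v ∧ IsOne σ v)) ∧
    ∃ i, i < k ∧ ∃ v, v ≤ y ∧ (Entry y i v ∧ ¬ IsOne σ v)

/-- The string `σ` of length `l` splits each sequence of `2e + 2` distinct numbers that is
enumerated by `R` at `e` before stage `l`. -/
def SplitsAll (R : M → M → M → Prop) (σ l : M) : Prop :=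
  ∀ e, e < l → ∀ m, m < l → ∀ y, y < l → R m e y → InjSeq y (e + e + 1 + 1) →
    Splits σ y (e + e + 1 + 1)

variable (R : M → M → M → Prop)

theorem exists_splitsAll [Fact (RCA0 S)]
    (hR : ∀ {n : ℕ} (s t u : (Fin n → M) → M) [IsTm s] [IsTm t] [IsTm u],
      D0 S (fun v => R (s v) (t v) (u v)))
    (hRu : ∀ e m m' y y', R m e y → R m' e y' → y = y') (l : M) :
    ∃ σ, IsString σ ∧ Len σ l ∧ SplitsAll R σ l := by
  -- `u` lists the reserved numbers: entry `2d` will get color 0 and entry `2d + 1` color 1.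
  obtain ⟨u, hu, h⟩ := (sig_induction S (fun e => ∃ u, InjSeq u (e + e) ∧
    ∀ d, d < e → ∀ m, m < l → ∀ y, y < l → R m d y → InjSeq y (d + d + 1 + 1) →
      ∃ v w, (∃ i, i < d + d + 1 + 1 ∧ Entry y i v) ∧ (∃ i, i < d + d + 1 + 1 ∧ Entry y i w) ∧
        Entry u (d + d) v ∧ Entry u (d + d + 1) w)
    ⟨0, by simp [InjSeq], by simp⟩
    (by
      rintro e ⟨u, hu, h⟩
      have lt : ∀ a : M, a < a + 1 := fun a => Order.lt_add_one_iff.2 le_rfl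
      obtain ⟨u', u'', v, w, h₁, h₂, h₃, h₄, h₅, h₆⟩ : ∃ u' u'' v w, InjSeq u'' (e + e + 1 + 1) ∧
          (∀ i, i < e + e → ∀ x, Entry u i x → Entry u' i x) ∧
          (∀ i, i < e + e + 1 → ∀ x, Entry u' i x → Entry u'' i x) ∧
          Entry u' (e + e) v ∧ Entry u'' (e + e + 1) w ∧
          ∀ m, m < l → ∀ y, y < l → R m e y → InjSeq y (e + e + 1 + 1) →
            (∃ i, i < e + e + 1 + 1 ∧ Entry y i v) ∧ (∃ i, i < e + e + 1 + 1 ∧ Entry y i w) := by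
        -- This unbounded question is decided outside the induction formula. By `hRu`, at most one
        -- sequence has to be served.
        by_cases H : ∃ m y, R m e y ∧ InjSeq y (e + e + 1 + 1)
        · obtain ⟨m, y, hm, hy⟩ := H
          obtain ⟨i, v, hi, hv, hv'⟩ := hu.exists_fresh S hy ((lt _).trans (lt _))
          obtain ⟨u', h₁, h₂, h₃⟩ := hu.append S hv'
          obtain ⟨j, w, hj, hw, hw'⟩ := h₁.exists_fresh S hy (lt _)
          obtain ⟨u'', h₄, h₅, h₆⟩ := h₁.append S hw'
          refine ⟨u', u'', v, w, h₄, h₂, h₅, h₃, h₆, fun m' _ y' _ hm' _ => ?_⟩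
          obtain rfl := hRu _ _ _ _ _ hm hm'
          exact ⟨⟨i, hi, hv⟩, ⟨j, hj, hw⟩⟩
        -- With nothing to split, dummy numbers above the codes keep the positions aligned.
        · obtain ⟨u', h₁, h₂, h₃⟩ := hu.append S (a := u + 1) fun i _ h => (lt u).not_ge h.le
          obtain ⟨u'', h₄, h₅, h₆⟩ := h₁.append S (a := u' + 1) fun i _ h => (lt u').not_ge h.le
          exact ⟨u', u'', _, _, h₄, h₂, h₅, h₃, h₆, fun m _ y _ hm hy => (H ⟨m, y, hm, hy⟩).elim⟩
      have e₂ : e + 1 + (e + 1) = e + e + 1 + 1 := by ring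
      refine ⟨u'', e₂ ▸ h₁, fun d hd m hm y hy hRy hyi => ?_⟩
      rcases (Order.lt_add_one_iff.1 hd).lt_or_eq with hd | rfl
      · obtain ⟨v, w, ha, hb, hc, hc'⟩ := h d hd m hm y hy hRy hyi
        have hde := add_self_add_one_lt hd
        exact ⟨v, w, ha, hb, h₃ _ (((lt _).trans hde).trans (lt _)) _ (h₂ _ ((lt _).trans hde) _ hc),
          h₃ _ (hde.trans (lt _)) _ (h₂ _ hde _ hc')⟩
      · exact ⟨v, w, (h₆ m hm y hy hRy hyi).1, (h₆ m hm y hy hRy hyi).2, h₃ _ (lt _) _ h₄, h₅⟩)) l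
  -- The ones are the odd-indexed reserved numbers. Even-indexed ones get zero since the entries of
  -- `u` are distinct, and relevant entries are at most `y < l`.
  obtain ⟨σ, hσ, hl, hσ'⟩ := exists_string (S := S) (fun x => ∃ d, d < l ∧ Entry u (d + d + 1) x) l
  refine ⟨σ, hσ, hl, fun e he m hm y hy hRy hyi => ?_⟩
  obtain ⟨v, w, ⟨i, hi, hv⟩, ⟨j, hj, hw⟩, huv, huw⟩ := h e he m hm y hy hRy hyi
  refine ⟨⟨j, hj, w, hw.le, hw, (hσ' w (hw.le.trans_lt hy)).2 ⟨e, he, huw⟩⟩,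
    ⟨i, hi, v, hv.le, hv, fun H => ?_⟩⟩
  obtain ⟨d, hd, hdv⟩ := (hσ' v (hv.le.trans_lt hy)).1 H
  exact add_self_ne_add_self_add_one d e (hu.2 _ (add_lt_add he he) _ (add_self_add_one_lt hd) v
    huv.le huv hdv)

/-- The argument uses only that `R` is a bounded relation enumerating at most one value for each
`e`; the machine model plays no role. -/
theorem exists_diagonal [Fact (RCA0 S)] (hRKL : RKL S)
    (hR : ∀ {n : ℕ} (s t u : (Fin n → M) → M) [IsTm s] [IsTm t] [IsTm u],
      D0 S (fun v => R (s v) (t v) (u v)))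
    (hRu : ∀ e m m' y y', R m e y → R m' e y' → y = y') :
    ∃ F ∈ S, IsFunction F ∧ ∀ m e y, R m e y → pair e y ∉ F := by
  have hRCA : RCA0 S := Fact.out
  obtain ⟨T, hTS, hT⟩ := hRCA.comprehension
    (fun σ => IsString σ ∧ ∃ l, l ≤ σ ∧ (Len σ l ∧ SplitsAll R σ l))
    (hP := by unfold SplitsAll Splits; infer_instance)
  obtain ⟨H, hHS, hH, c, hc, hpath⟩ := hRKL T hTS
    ⟨fun σ hσ => ((hT σ).1 hσ).1, fun σ hσ τ hτ hτσ => by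
      obtain ⟨-, l, -, hl, hs⟩ := (hT σ).1 hσ
      obtain ⟨k, l', hk, hl', hkl, hone⟩ := hτσ
      obtain rfl := hl.unique hl'
      -- A sequence with code `y < k` has all its entries below `k`, where `τ` agrees with `σ`.
      refine (hT τ).2 ⟨hτ, k, hk.le, hk, fun e he m hm y hy hRy hyi => ?_⟩
      have hkl := not_lt.1 hkl
      obtain ⟨⟨i, hi, v, hv, hiv, h₁⟩, ⟨j, hj, w, hw, hjw, h₂⟩⟩ :=
        hs e (he.trans_le hkl) m (hm.trans_le hkl) y (hy.trans_le hkl) hRy hyi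
      exact ⟨⟨i, hi, v, hv, hiv, (hone v (hv.trans_lt hy)).2 h₁⟩,
        ⟨j, hj, w, hw, hjw, fun H => h₂ ((hone w (hw.trans_lt hy)).1 H)⟩⟩⟩
    (fun b => by
      obtain ⟨σ, hσ, hl, hs⟩ := exists_splitsAll (S := S) R hR hRu (b + 1)
      exact ⟨σ, (hT σ).2 ⟨hσ, b + 1, hl.le, hl, hs⟩,
        (Order.lt_add_one_iff.2 le_rfl).trans_le hl.le⟩)
  have : Fact (H ∈ S) := ⟨hHS⟩
  let good : M → M → Prop := fun e y => InjSeq y (e + e + 1 + 1) ∧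
    ∀ i, i < e + e + 1 + 1 → ∃ v, v ≤ y ∧ (Entry y i v ∧ v ∈ H)
  obtain ⟨F, hFS, hF⟩ := hRCA.comprehension
    (fun z => ∃ e, e ≤ z ∧ ∃ y, y ≤ z ∧ (z = pair e y ∧ good e y ∧ ∀ x, x < y → ¬ good e x))
    (hP := by unfold good; infer_instance)
  have hF' : ∀ e y, pair e y ∈ F ↔ good e y ∧ ∀ x, x < y → ¬ good e x := by
    intro e y
    rw [hF]
    constructor
    · rintro ⟨e', -, y', -, h, h'⟩
      obtain ⟨rfl, rfl⟩ := pair_inj h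
      exact h'
    · intro h
      exact ⟨e, left_le_pair e y, y, right_le_pair e y, rfl, h⟩
  refine ⟨F, hFS, ⟨fun z hz => ?_, fun e => ?_⟩, fun m e y hm hy => ?_⟩
  · obtain ⟨e, -, y, -, rfl, -⟩ := (hF z).1 hz
    exact ⟨e, y, rfl⟩
  · obtain ⟨y, hy⟩ := exists_injSeq_mem (S := S) hH (e + e + 1 + 1)
    obtain ⟨y, hy, hmin⟩ := exists_least S (good e) hy (by unfold good; infer_instance)
    refine ⟨y, (hF' e y).2 ⟨hy, hmin⟩, fun y' hy' => ?_⟩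
    obtain ⟨h₁, h₂⟩ := (hF' e y').1 hy'
    exact le_antisymm (not_lt.1 fun h => h₂ y h hy) (not_lt.1 fun h => hmin y' h h₁)
  · obtain ⟨⟨hinj, hmem⟩, -⟩ := (hF' e y).1 hy
    -- This length makes the requirement for `e`, `m`, `y` active, so `σ` splits a sequence of
    -- elements of `H`.
    obtain ⟨σ, hσ, ⟨l, hl, hkl⟩, hhom⟩ := hpath (max e (max m y))
    obtain ⟨-, l', -, hl', hs⟩ := (hT σ).1 hσ
    obtain rfl := hl.unique hl'
    simp only [max_lt_iff] at hkl
    obtain ⟨⟨i, hi, v, -, hiv, h₁⟩, ⟨j, hj, w, -, hjw, h₂⟩⟩ :=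
      hs e hkl.1 m hkl.2.1 y hkl.2.2 hm hinj
    have mem : ∀ i v, i < e + e + 1 + 1 → Entry y i v → v ∈ H := by
      intro i v hi hv
      obtain ⟨x, -, hx, hxH⟩ := hmem i hi
      exact hx.unique hv ▸ hxH
    have hv := hhom l hl v (mem i v hi hiv) (hiv.le.trans_lt hkl.2.2)
    have hw := hhom l hl w (mem j w hj hjw) (hjw.le.trans_lt hkl.2.2)
    rcases hw with ⟨-, hw⟩ | ⟨rfl, -⟩
    · exact h₂ hw
    · rcases hv with ⟨h, -⟩ | ⟨-, -, -, -, hv⟩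
      · exact zero_ne_one h
      · exact hv h₁

/-- The `Σ⁰₁` form of the diagonal computation provides a bounded matrix for `exists_diagonal`, and
determinism provides uniqueness of its values. -/
theorem dnr_of_rkl [Fact (RCA0 S)] (hRKL : RKL S) : DNR S := by
  intro X hX
  have : Fact (X ∈ S) := ⟨hX⟩
  have := S1.phi (S := S) X
  obtain ⟨Q, hQ, hQD⟩ := S1.exists_repr (S := S) (fun v : Fin 2 → M => Phi X (v 0) (v 0) (v 1))
  obtain ⟨F, hFS, hF, h⟩ := exists_diagonal (S := S) (fun m e y => Q m ![e, y]) hRKL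
    (fun s t u _ _ _ => hQD s (fun v => Fin.cons (t v) (Fin.cons (u v) Fin.elim0)))
    (fun e m m' y y' hy hy' => Phi.unique (S := S) ((hQ ![e, y]).2 ⟨m, hy⟩)
      ((hQ ![e, y']).2 ⟨m', hy'⟩))
  refine ⟨F, hFS, hF, fun e y hy => ?_⟩
  obtain ⟨m, hm⟩ := (hQ ![e, y]).1 hy
  exact h m e y hm

end Diagonalization

end SOA

/-- `RKL` implies `DNR` over `RCA₀`: every model of `RCA₀ + RKL` is a model of `DNR`. -/
theorem mainTheorem1 {M : Type*} [Zero M] [One M] [Add M] [Mul M] [LT M] (S : Set (Set M))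
    (hRCA : SOA.RCA0 S) (hRKL : SOA.RKL S) : SOA.DNR S := by
  -- The model is made an ordered semiring with the given operations, as the sections on closure
  -- properties and beyond assume.
  let _ := hRCA.commSemiring
  let _ := hRCA.linearOrder
  have : CanonicallyOrderedAdd M :=
    { exists_add_of_le := fun {a b} h => (hRCA.le_iff a b).1 h
      le_add_self := fun a b => (hRCA.le_iff _ _).2 ⟨b, hRCA.add_comm _ _⟩
      le_self_add := fun a b => (hRCA.le_iff _ _).2 ⟨b, rfl⟩ }
  have hlt : ∀ a b c : M, a < b → c + a < c + b := fun a b c h => by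
    obtain ⟨d, rfl⟩ := (hRCA.lt_iff _ _).1 h
    exact (hRCA.lt_iff _ _).2 ⟨d, hRCA.add_assoc _ _ _⟩
  have : IsOrderedAddMonoid M :=
    { add_le_add_left := fun a b h c => by
        rw [hRCA.add_comm a, hRCA.add_comm b]
        exact h.imp (hlt a b c) (congrArg (c + ·)) }
  have : IsOrderedCancelAddMonoid M :=
    { le_of_add_le_add_left := fun a b c h => not_lt.1 fun h' => (hlt c b a h').not_ge h }
  have : Nontrivial M := ⟨0 + 1, 0, hRCA.succ_ne_zero 0⟩
  have hmul : ∀ a : M, 0 < a → ∀ b c : M, b < c → a * b < a * c := fun a ha b c h => by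
    obtain ⟨d, rfl⟩ := (hRCA.lt_iff _ _).1 h
    rw [hRCA.left_distrib, hRCA.mul_succ]
    refine lt_add_of_pos_right _ (lt_of_lt_of_le ha ?_)
    exact le_add_self
  have : IsStrictOrderedRing M :=
    { zero_le_one := (hRCA.le_iff _ _).2 ⟨1, (hRCA.zero_add 1).symm⟩
      mul_lt_mul_of_pos_left := fun a ha b c h => hmul a ha b c h
      mul_lt_mul_of_pos_right := fun a ha b c h => by
        rw [hRCA.mul_comm b, hRCA.mul_comm c]; exact hmul a ha b c h }
  let _ : SuccAddOrder M :=
    { succ := fun a => a + 1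
      le_succ := fun a => le_self_add
      max_of_succ_le := fun {a} h => ((hRCA.lt_succ a a).2 (.inr rfl)).not_ge h |>.elim
      succ_le_of_lt := fun {a b} h => by
        obtain ⟨d, rfl⟩ := (hRCA.lt_iff _ _).1 h
        exact (hRCA.le_iff _ _).2 ⟨d, by rw [hRCA.add_assoc, hRCA.add_comm d]⟩
      succ_eq_add_one := fun a => rfl }
  have : Fact (SOA.RCA0 S) := ⟨hRCA⟩
  exact SOA.dnr_of_rkl (S := S) hRKL
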